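/- **Setting.** Let $(V,Y,\mathbf 1,\omega)$ be a simple vertex operator algebra over $\mathbb C$ of central charge $c$ and strong CFT-type: $V=\bigoplus_{n\ge 0}V_n$ with $\dim V_n<\infty$, $V_0=\mathbb C\mathbf 1$ and $L(1)V_1=0$. Write $Y(u,z)=\sum_n u(n)z^{-n-1}$ and $L(n)=\omega(n+1)$. Let $\langle\ ,\ \rangle$ be its invariant symmetric bilinear form with $\langle\mathbf 1,\mathbf 1\rangle=1$. Let $V_\omega$ be the span of the Virasoro descendants $L(-n_1)\cdots L(-n_k)\mathbf 1$, $n_i\ge 2$, of the vacuum, and $\Pi_n=\{u\in V_n: L(m)u=0 \text{ for all } m>0\}$. For $l\ge 1$, $V$ is an *Exceptional VOA of lowest primary weight $l$* if * $\Pi_l\neq 0$ and $\Pi_k=0$ for $1\le k<l$; * $\lambda^{(2l+2)}=\sum_i u_i(-3)\bar u_i\in V_\omega$, where $\{u_i\}$ is a basis of $\Pi_l$ and $\{\bar u_i\}$ the dual basis, $\langle u_i,\bar u_j\rangle=\delta_{ij}$; * in the weights $n\le 2l+2$ the vectors $L(-n_1)\cdots L(-n_k)\mathbf 1$ ($n_1\ge\dots\ge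 n_k\ge 2$, $\sum n_i=n$) are linearly independent, and $V_\omega$ contains no nonzero Virasoro singular vector of weight $0<n\le 2l+2$ (by the Kac determinant formula: $c\ne 1-6(p-q)^2/pq$ for coprime $p,q\ge2$ with $(p-1)(q-1)\le 2l+2$). Put $p_l=\dim\Pi_l$ and, for $a,b\in\Pi_l$, $F(a,b;x,y)=\sum_i\langle a,Y(u_i,x)Y(\bar u_i,y)b\rangle$. **Rational functions of $c$.** For a partition $I=(i_1\ge\dots\ge i_k\ge 2)$ of $n$ put $\rho_l(I)=\prod_{j=1}^k\bigl(i_{j+1}+\dots+i_k+l(i_j-1)\bigr)$. Let $\Gamma_n$ be the Gram matrix of the vectors $L(-i_1)\cdots L(-i_k)\mathbf 1$ of weight $n$ in the universal Virasoro vacuum module of central charge $c$; its entries are polynomials in $c$. Let $$\mathcal V_l(\eta)=\sum_{n\ge0}\Bigl(\sum_{I,J}\rho_l(I)\,(\Gamma_n^{-1})_{IJ}\,\rho_l(J)\Bigr)\eta^n\in\mathbb Q(c)[[\eta]].$$ With $[\eta^n]$ denoting the coefficient of $\eta^n$, define the following elements of $\mathbb Q(c)$, which depend only on $l$: $$v_k=[\eta^{2k}]\,(1-\tfrac{\eta}{2})(1-\eta)^{k-1}\mathcal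 V_l(\eta),\qquad w_j=[\eta^{j}]\,(1+\eta)(1-\eta)^{-(2l+1-2j)}\,\mathcal V_l(\eta).$$ **Proposition.** Let $l\ge 1$. 1. The $l\times l$ matrix $M_{mk}=\binom{m}{2k}+\binom{-m}{2k}$ $(1\le m,k\le l)$ has determinant $1$. 2. $v_{l+1}$ is not the zero rational function. 3. Let $V$ be an Exceptional VOA of lowest primary weight $l$ and central charge $c$. Then $v_k$ $(0\le k\le l+1)$ and $w_j$ $(0\le j<l)$ have no pole at $c$, and the genus zero correlation function is uniquely determined: for all $a,b\in\Pi_l$, $F(a,b;x,y)$ is the expansion in the domain $|x|>|y|$ of $$\frac{G(a,b;x,y)}{x^{2l}y^{2l}(x-y)^{2l}},$$ where $G(a,b;x,y)$ is the symmetric polynomial, homogeneous of degree $4l$, $$G(a,b;x,y)=(-1)^l\langle a,b\rangle\Bigl(p_l\sum_{k=0}^{l}v_k(c)\,(x-y)^{2k}(xy)^{2l-k}+\sum_{j=0}^{l-1}w_j(c)\,(x-y)^{4l-2j}(xy)^{j}\Bigr).$$ 4. For such $V$, $\;p_l\,v_{l+1}(c)=w_{l-1}(c)$. Hence, whenever $v_{l+1}(c)\neq0$,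 $\;p_l=p_l(c)$ is the value at $c$ of the specific rational function $w_{l-1}/v_{l+1}$, and $F$ is determined by $l$, $c$ and $\langle\ ,\ \rangle$ alone. -/

import Mathlib

open scoped BigOperators

noncomputable section

/-! ### Vertex operator algebras over the complex numbers -/

section VOADefs

variable {V : Type*} [AddCommGroup V] [Module ℂ V]

/-- The mode `u(n)` of the vertex operator `Y(u,z) = ∑ u(n) z^{-n-1}`. -/
def vmode (Y : V →ₗ[ℂ] VertexOperator ℂ V) (u : V) (n : ℤ) : Module.End ℂ V :=
  VertexOperator.ncoeff (Y u) n

/-- A vertex operator algebra structure on `V`. Lower truncation is part of Mathlib's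
`VertexOperator` (its values are Laurent series). The Virasoro modes are `L(n) = ω(n+1)`.
The Jacobi identity is written in modes (all sums over `i` are finite by lower truncation).
That `vac` has weight `0` and `omega` has weight `2` follows from the other axioms. -/
structure VOA (V : Type*) [AddCommGroup V] [Module ℂ V] where
  Y : V →ₗ[ℂ] VertexOperator ℂ V
  vac : V
  omega : V
  /-- the central charge -/
  c : ℂ
  vac_mode : ∀ (n : ℤ) (v : V), vmode Y vac n v = if n = -1 then v else 0
  create_nonneg : ∀ (u : V) (n : ℤ), 0 ≤ n → vmode Y u n vac = 0
  create : ∀ u : V, vmode Y u (-1) vac = u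
  virasoro : ∀ m n : ℤ,
    vmode Y omega (m + 1) * vmode Y omega (n + 1) - vmode Y omega (n + 1) * vmode Y omega (m + 1)
      = ((m : ℂ) - n) • vmode Y omega (m + n + 1)
        + if m + n = 0 then (c / 12 * ((m : ℂ) ^ 3 - m)) • (1 : Module.End ℂ V) else 0
  translation : ∀ (u : V) (n : ℤ),
    vmode Y (vmode Y omega 0 u) n = (-(n : ℂ)) • vmode Y u (n - 1)
  jacobi : ∀ (u v w : V) (p q r : ℤ),
    ∑ᶠ i : ℕ, Ring.choose p i • vmode Y (vmode Y u (r + i) v) (p + q - i) w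
      = ∑ᶠ i : ℕ, ((-1 : ℂ) ^ i * (Ring.choose r i : ℤ)) •
          (vmode Y u (p + r - i) (vmode Y v (q + i) w)
            - (-1 : ℂ) ^ r • vmode Y v (q + r - i) (vmode Y u (p + i) w))
  grading : ⨆ n : ℤ, Module.End.eigenspace (vmode Y omega 1) (n : ℂ) = ⊤
  finite_weight : ∀ n : ℤ,
    FiniteDimensional ℂ (Module.End.eigenspace (vmode Y omega 1) (n : ℂ))

namespace VOA

variable (A : VOA V)

/-- The mode `u(n)`. -/
def mode (u : V) (n : ℤ) : Module.End ℂ V := vmode A.Y u n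

/-- The Virasoro operator `L(n) = ω(n+1)`. -/
def L (n : ℤ) : Module.End ℂ V := A.mode A.omega (n + 1)

/-- The weight space `V_n`. -/
def wt (n : ℤ) : Submodule ℂ V := Module.End.eigenspace (A.L 0) (n : ℂ)

/-- `V` is simple: nonzero, and its only ideals are `0` and `V`. -/
def IsSimple : Prop :=
  Nontrivial V ∧ ∀ I : Submodule ℂ V,
    (∀ (u : V) (n : ℤ), ∀ v ∈ I, A.mode u n v ∈ I) → I = ⊥ ∨ I = ⊤

/-- Strong CFT-type: `V = ⨁_{n ≥ 0} V_n`, `V_0 = ℂ 1` and `L(1) V_1 = 0`. -/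
def IsStrongCFT : Prop :=
  (∀ n : ℤ, n < 0 → A.wt n = ⊥) ∧ A.wt 0 = Submodule.span ℂ {A.vac} ∧
    ∀ v ∈ A.wt 1, A.L 1 v = 0

/-- `B` is the symmetric bilinear form with `⟨1,1⟩ = 1` that is invariant:
`⟨Y(e^{zL(1)} (-z^{-2})^{L(0)} w, z^{-1}) u, v⟩ = ⟨u, Y(w,z) v⟩`, in modes for `w ∈ V_h`. -/
def IsInvariantForm (B : LinearMap.BilinForm ℂ V) : Prop :=
  (∀ u v : V, B u v = B v u) ∧ B A.vac A.vac = 1 ∧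
    ∀ (h : ℤ), ∀ w ∈ A.wt h, ∀ (u v : V) (n : ℤ),
      B (∑ᶠ i : ℕ, ((-1 : ℂ) ^ h * ((i.factorial : ℂ))⁻¹) •
          A.mode ((A.L 1 ^ i) w) (2 * h - n - 2 - i) u) v = B u (A.mode w n v)

/-- The space `Π_n` of Virasoro primary vectors of weight `n`. -/
def primary (n : ℕ) : Submodule ℂ V :=
  A.wt n ⊓ ⨅ m : {m : ℤ // 0 < m}, LinearMap.ker (A.L m)

/-- `p_n = dim Π_n`. -/
def primaryDim (n : ℕ) : ℕ := Module.finrank ℂ (A.primary n)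

/-- The Virasoro descendant `L(-n_1) ⋯ L(-n_k) 1` of the vacuum. -/
def fock (w : List ℕ) : V := w.foldr (fun n v => A.L (-(n : ℤ)) v) A.vac

/-- The subalgebra `V_ω` of Virasoro descendants of the vacuum. -/
def virasoroSub : Submodule ℂ V :=
  Submodule.span ℂ {v | ∃ w : List ℕ, (∀ n ∈ w, 2 ≤ n) ∧ A.fock w = v}

end VOA

end VOADefs

/-! ### The Fock basis of the Virasoro vacuum module -/

/-- Partitions of `n` without a part equal to `1`. They index the Fock vectors of weight `n`. -/
abbrev VacPartition (n : ℕ) : Type := {P : n.Partition // 1 ∉ P.parts}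

/-- The parts of a partition in nonincreasing order. -/
def VacPartition.list {n : ℕ} (P : VacPartition n) : List ℕ :=
  P.1.parts.sort (fun a b => b ≤ a)

section VOADefs2

variable {V : Type*} [AddCommGroup V] [Module ℂ V]

namespace VOA

variable (A : VOA V)

/-- Up to weight `N` the Fock vectors are linearly independent and `V_ω` contains no Virasoro
singular vector of positive weight. -/
def NoSingularUpTo (N : ℕ) : Prop :=
  ∀ n : ℕ, n ≤ N →
    LinearIndependent ℂ (fun P : VacPartition n => A.fock P.list) ∧
      (0 < n → ∀ v ∈ A.virasoroSub ⊓ A.wt n, (∀ m : ℤ, 0 < m → A.L m v = 0) → v = 0)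

/-- `u'` is the basis of `Π_l` dual to `u`: `⟨u_i, u'_j⟩ = δ_{ij}`. -/
def IsDualBasis (B : LinearMap.BilinForm ℂ V) (l : ℕ)
    (u : Module.Basis (Fin (A.primaryDim l)) ℂ (A.primary l))
    (u' : Fin (A.primaryDim l) → A.primary l) : Prop :=
  ∀ i j, B (u i : V) (u' j : V) = if i = j then 1 else 0

/-- The quadratic Casimir vector `λ^{(n)} = ∑_i u_i(2l-n-1) u'_i`. -/
def casimir (l : ℕ) (u : Module.Basis (Fin (A.primaryDim l)) ℂ (A.primary l))
    (u' : Fin (A.primaryDim l) → A.primary l) (n : ℕ) : V :=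
  ∑ i, A.mode (u i : V) (2 * (l : ℤ) - n - 1) (u' i : V)

/-- `A` is an Exceptional VOA of lowest primary weight `l`, with normalised invariant form `B`. -/
structure IsExceptional (B : LinearMap.BilinForm ℂ V) (l : ℕ) : Prop where
  simple : A.IsSimple
  strongCFT : A.IsStrongCFT
  form : A.IsInvariantForm B
  one_le : 1 ≤ l
  primary_ne : A.primary l ≠ ⊥
  lowest : ∀ k : ℕ, 1 ≤ k → k < l → A.primary k = ⊥
  noSingular : A.NoSingularUpTo (2 * l + 2)
  casimir_mem : ∀ u u', A.IsDualBasis B l u u' → A.casimir l u u' (2 * l + 2) ∈ A.virasoroSub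

end VOA

end VOADefs2

/-! ### Rational functions of the central charge -/

/-- The vacuum expectation value `⟨1, L(n_1) ⋯ L(n_k) 1⟩` at central charge `c`, computed by
commuting the leftmost mode to the right. -/
def virVev {K : Type*} [Field K] (c : K) : List ℤ → K
  | [] => 1
  | n :: w =>
    if n ≤ 1 then 0
    else ∑ i : Fin w.length,
      (((n : K) - (w.get i : K)) * virVev c (w.set i (n + w.get i))
        + if n + w.get i = 0 then c / 12 * ((n : K) ^ 3 - n) * virVev c (w.eraseIdx i) else 0)
  termination_by w => w.length
  decreasing_by
    all_goals simp_wf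
    all_goals grind

/-- The Gram matrix `⟨L(-I) 1, L(-J) 1⟩` of the Fock vectors of weight `n`. -/
def virGram {K : Type*} [Field K] (c : K) (n : ℕ) :
    Matrix (VacPartition n) (VacPartition n) K :=
  Matrix.of fun I J =>
    virVev c (I.list.reverse.map (fun k => (k : ℤ)) ++ J.list.map (fun k => -(k : ℤ)))

/-- `ρ_l(n_1,…,n_k) = ∏_j (n_{j+1} + ⋯ + n_k + l (n_j - 1))`. -/
def casimirRho (l : ℕ) : List ℕ → ℤ
  | [] => 1
  | i :: w => ((w.sum : ℤ) + l * ((i : ℤ) - 1)) * casimirRho l w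

/-- `V_n = ∑_{I,J} ρ_l(I) (Gram⁻¹)_{IJ} ρ_l(J)`, a rational function of the central charge. -/
def blockCoeff (l n : ℕ) : RatFunc ℚ :=
  ∑ I : VacPartition n, ∑ J : VacPartition n,
    (casimirRho l I.list : RatFunc ℚ) * (virGram (RatFunc.X : RatFunc ℚ) n)⁻¹ I J
      * (casimirRho l J.list : RatFunc ℚ)

/-- The series `V(η) = ∑ V_n η^n`. -/
def blockSeries (l : ℕ) : PowerSeries (RatFunc ℚ) := PowerSeries.mk (blockCoeff l)

/-- `v_k = [η^{2k}] (1 - η/2) (1 - η)^{k-1} V(η)`, which is the coefficient of `t^k` in `V` as a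
series in `t = η²/(1-η)`. (For `k = 0` the truncated exponent is harmless: `v_0 = V_0 = 1`.) -/
def vCoeff (l k : ℕ) : RatFunc ℚ :=
  PowerSeries.coeff (2 * k)
    ((1 - PowerSeries.C (1 / 2 : RatFunc ℚ) * PowerSeries.X) *
      (1 - PowerSeries.X) ^ (k - 1) * blockSeries l)

/-- `w_j = [η^j] (1 + η) (1 - η)^{-(2l+1-2j)} V(η)`, for `j ≤ l`, which is the coefficient of `s^j`
in `(1-η)^{-2l} V(η)` as a series in `s = η/(1-η)²`. -/
def wCoeff (l j : ℕ) : RatFunc ℚ :=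
  PowerSeries.coeff j
    ((1 + PowerSeries.X) * ((1 - PowerSeries.X : PowerSeries (RatFunc ℚ))⁻¹) ^ (2 * l + 1 - 2 * j)
      * blockSeries l)

/-- The rational function `p_l(c) = w_{l-1}(c) / v_{l+1}(c)`. -/
def plFun (l : ℕ) : RatFunc ℚ := wCoeff l (l - 1) / vCoeff l (l + 1)

/-- The value of a rational function at a complex number where it is regular. -/
def evalC (f : RatFunc ℚ) (c : ℂ) : ℂ := RatFunc.eval (algebraMap ℚ ℂ) c f

/-- `f` has no pole at `c`. -/
def IsRegularAt (f : RatFunc ℚ) (c : ℂ) : Prop := Polynomial.aeval c f.denom ≠ 0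

/-! ### Genus zero correlation functions -/

/-- The polynomial
`(-1)^l (p ∑_{k=0}^{l} v_k(c) (x-y)^{2k} (xy)^{2l-k} + ∑_{j=0}^{l-1} w_j(c) (x-y)^{4l-2j} (xy)^j)`,
with `x = X 0` and `y = X 1`. -/
def genusZeroPoly (l p : ℕ) (c : ℂ) : MvPolynomial (Fin 2) ℂ :=
  (-1) ^ l *
    (MvPolynomial.C (p : ℂ) * ∑ k ∈ Finset.range (l + 1),
        MvPolynomial.C (evalC (vCoeff l k) c) *
          (MvPolynomial.X 0 - MvPolynomial.X 1) ^ (2 * k) *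
          (MvPolynomial.X 0 * MvPolynomial.X 1) ^ (2 * l - k)
      + ∑ j ∈ Finset.range l,
        MvPolynomial.C (evalC (wCoeff l j) c) *
          (MvPolynomial.X 0 - MvPolynomial.X 1) ^ (4 * l - 2 * j) *
          (MvPolynomial.X 0 * MvPolynomial.X 1) ^ j)

/-- The coefficient of `x^i y^j` in the expansion of `G(x,y) / (x^{2l} y^{2l} (x-y)^{2l})` in the
domain `|x| > |y|`, where `(x-y)^{-2l} = ∑_k binom(2l-1+k, k) x^{-2l-k} y^k` (for `l ≥ 1`). -/
def expansionCoeff (l : ℕ) (G : MvPolynomial (Fin 2) ℂ) (i j : ℤ) : ℂ :=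
  ∑ d ∈ G.support, ∑ᶠ k : ℕ,
    if (d 0 : ℤ) - 4 * l - k = i ∧ (d 1 : ℤ) - 2 * l + k = j then
      MvPolynomial.coeff d G * ((2 * l - 1 + k).choose k : ℂ) else 0

/-- The coefficient of `x^{-m-1} y^{-n-1}` in the genus zero correlation function
`F(a,b;x,y) = ∑_i ⟨a, Y(u_i,x) Y(u'_i,y) b⟩`. -/
def VOA.corrCoeff {V : Type*} [AddCommGroup V] [Module ℂ V] (A : VOA V)
    (B : LinearMap.BilinForm ℂ V) (l : ℕ)
    (u : Module.Basis (Fin (A.primaryDim l)) ℂ (A.primary l))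
    (u' : Fin (A.primaryDim l) → A.primary l) (a b : V) (m n : ℤ) : ℂ :=
  ∑ i, B a (A.mode (u i : V) m (A.mode (u' i : V) n b))

/-- The matrix `M_{mk} = binom(m, 2k) + binom(-m, 2k)` for `m, k = 1, …, l`. -/
def binomMatrix (l : ℕ) : Matrix (Fin l) (Fin l) ℤ :=
  Matrix.of fun m k =>
    Ring.choose ((m : ℤ) + 1) (2 * ((k : ℕ) + 1)) + Ring.choose (-((m : ℤ) + 1)) (2 * ((k : ℕ) + 1))

end

/-! For weight reasons $F$ is encoded in the single series $\Phi(z)=\sum_N\sum_i\langle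
a,u_i(N-1)\bar u_i(2l-1-N)b\rangle z^N$, that is, $x=1$ and $y=z$. Locality and the symmetry of
$\sum_i u_i\otimes\bar u_i$ make $(1-z)^{2l}\Phi$ a palindromic polynomial of degree at most $4l$,
hence of the form $\sum_{k\le 2l}g_k(1-z)^{2k}z^{2l-k}$ (`exists_expansion_of_palindromic`). There
are $2l+1$ unknowns $g_k$.

Two expansions determine them. At $z=1$, associativity turns $\Phi$ into matrix elements of zero
modes of the Casimir vectors, and the $g_k$ become coefficients in $t=\eta^2/(1-\eta)$. These
vectors lie in $V_\omega$ up to weight $2l+2$, which gives $g_k$ for $k\le l+1$, with a factor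
$p_l=\sum_i\langle u_i,\bar u_i\rangle$ (`quadratic_coeff_of_expansion`, `sum_iterateElt`). At $z=0$
the $g_{2l-j}$ are coefficients in $s=\eta/(1-\eta)^2$. Intermediate states of weight below $l$ are
Virasoro descendants of the vacuum, which gives $g_{2l-j}$ for $j<l$, without $p_l$
(`koebe_coeff_of_expansion`, `sum_productElt`). Together all unknowns are covered, and $g_{l+1}$ is
covered twice: this is $p_lv_{l+1}=w_{l-1}$.

Both expansions involve the same numbers $\rho^T\Gamma_n^{-1}\rho$, because Virasoro modes move the
relevant vectors to multiples of one another, so pairings with Fock vectors produce $\rho_l$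
(`fock_pairing`, `fock_mode_primary`, `eq_blockVal`). The Gram matrices are invertible at the
central charge of $V$, since a null vector would lead to a singular vector (`det_virGram_ne`). The
same fact gives the absence of poles.

For $v_{l+1}\ne0$ let $c\to\infty$: rescaled Virasoro modes become free, only the one-part partition
contributes at order $1/c$, and the limit of $c\,v_{l+1}$ is a nonzero multiple of the integral of a
nonnegative function (`tendsto_blockVal`, `sum_quadratic_functional_ne_zero`). The binomial matrix
is a product of two unitriangular ones. -/

/-! ### Integral powers of `1 - X` as power series -/

namespace PowerSeries

/-- The power series of `(1 - X) ^ r` for an integer `r`. -/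
noncomputable def oneSubZPow (R : Type*) [CommRing R] (r : ℤ) : PowerSeries R :=
  rescale (-1 : R) (binomialSeries R r)

section

variable {R : Type*} [CommRing R]

theorem coeff_oneSubZPow (r : ℤ) (n : ℕ) :
    coeff n (oneSubZPow R r) = (-1) ^ n * ((Ring.choose r n : ℤ) : R) := by
  simp [oneSubZPow, coeff_rescale]

@[simp]
theorem constantCoeff_oneSubZPow (r : ℤ) : constantCoeff (oneSubZPow R r) = 1 := by
  rw [← coeff_zero_eq_constantCoeff_apply, coeff_oneSubZPow]
  simp

theorem oneSubZPow_add (r s : ℤ) :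
    oneSubZPow R (r + s) = oneSubZPow R r * oneSubZPow R s := by
  simp [oneSubZPow]

theorem oneSubZPow_natCast (d : ℕ) : oneSubZPow R (d : ℤ) = (1 - X) ^ d := by
  rw [oneSubZPow, binomialSeries_nat]
  simp [sub_eq_add_neg, rescale_X]

theorem oneSubZPow_zero : oneSubZPow R 0 = 1 := by
  simp [oneSubZPow]

theorem coeff_oneSubZPow_natCast (d n : ℕ) :
    coeff n (oneSubZPow R (d : ℤ)) = (-1) ^ n * (d.choose n : R) := by
  rw [coeff_oneSubZPow, Ring.choose_natCast, Int.cast_natCast]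

theorem coeff_oneSubZPow_neg (d n : ℕ) :
    coeff n (oneSubZPow R (-((d : ℤ) + 1))) = ((d + n).choose d : R) := by
  rw [oneSubZPow, show (-((d : ℤ) + 1)) = (-((d + 1 : ℕ) : ℤ)) by push_cast; ring,
    ← rescale_neg_one_invOneSubPow, coeff_rescale, coeff_rescale, ← mul_assoc, ← mul_pow]
  simp [invOneSubPow_val_succ_eq_mk_add_choose]

theorem oneSubZPow_mul_pow (r : ℤ) (i : ℕ) :
    oneSubZPow R r ^ i = oneSubZPow R (i * r) := by
  induction i with
  | zero => simp [oneSubZPow_zero]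
  | succ i ih => rw [pow_succ, ih, ← oneSubZPow_add]; congr 1; push_cast; ring

/-- Extraction of the coefficient of `s ^ j` from a series in `s = X / (1 - X) ^ 2`. -/
theorem coeff_series_in_koebe (N j : ℕ) (hj : j < N) (h : ℕ → R) :
    coeff j ((1 + X) * oneSubZPow R (2 * j - 1) *
      ∑ i ∈ Finset.range N, C (h i) * (X ^ i * oneSubZPow R (-(2 * i)))) = h j := by
  -- A residue computation: for s = X/(1-X)^2 one has ds/s = (1+X)/(1-X) dX/X, whence the weight
  -- (1+X)(1-X)^(2j-1). Powers i > j vanish by order.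
  rw [Finset.mul_sum, map_sum, Finset.sum_eq_single j]
  · have : (1 + X) * oneSubZPow R (2 * j - 1) * (C (h j) * (X ^ j * oneSubZPow R (-(2 * j))))
        = X ^ j * (C (h j) * ((1 + X) * oneSubZPow R ((2 * j - 1) + -(2 * j)))) := by
      rw [oneSubZPow_add]; ring
    rw [this, coeff_X_pow_mul', if_pos le_rfl, Nat.sub_self, coeff_C_mul]
    simp
  · intro i _ hij
    have : (1 + X) * oneSubZPow R (2 * j - 1) * (C (h i) * (X ^ i * oneSubZPow R (-(2 * i))))
        = X ^ i * (C (h i) * ((1 + X) * oneSubZPow R ((2 * j - 1) + -(2 * i)))) := by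
      rw [oneSubZPow_add]; ring
    rw [this, coeff_X_pow_mul']
    split_ifs with hle
    -- For i < j what remains is the coefficient of X^(r+1) in (1+X)(1-X)^(2r+1): the two middle
    -- binomials cancel.
    · obtain ⟨r, rfl⟩ : ∃ r, j = i + (r + 1) := ⟨j - i - 1, by omega⟩
      rw [show (2 * ((i + (r + 1) : ℕ) : ℤ) - 1) + -(2 * i) = ((2 * r + 1 : ℕ) : ℤ) by
        push_cast; ring, add_mul, one_mul, coeff_C_mul, Nat.add_sub_cancel_left, map_add,
        mul_comm X, coeff_succ_mul_X, coeff_oneSubZPow_natCast, coeff_oneSubZPow_natCast,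
        Nat.choose_symm_half]
      ring
    · rfl
  · intro hn; simp [hj] at hn

end

/-- Extraction of the coefficient of `t ^ k` from a series in `t = X ^ 2 / (1 - X)`. -/
theorem coeff_series_in_quadratic {R : Type*} [Field R] (N k : ℕ) (hk : k < N) (g : ℕ → R) :
    coeff (2 * k) ((1 - C (1 / 2 : R) * X) * (1 - X) ^ (k - 1) *
      ∑ i ∈ Finset.range N, C (g i) * (X ^ (2 * i) * oneSubZPow R (-i))) = g k := by
  -- Again a residue: t = X^2/(1-X) has dt/t = (2-X)/(1-X) dX/X. The order 2 of t at the origin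
  -- accounts for the factor 1/2 in 1 - X/2.
  rw [Finset.mul_sum, map_sum, Finset.sum_eq_single k]
  · have : (1 - C (1 / 2 : R) * X) * (1 - X) ^ (k - 1) *
        (C (g k) * (X ^ (2 * k) * oneSubZPow R (-k)))
        = X ^ (2 * k) * (C (g k) * ((1 - C (1 / 2 : R) * X) * ((1 - X) ^ (k - 1) *
          oneSubZPow R (-k)))) := by ring
    rw [this, coeff_X_pow_mul', if_pos le_rfl, Nat.sub_self, coeff_C_mul, ← oneSubZPow_natCast]
    simp
  · intro i _ hik
    have : (1 - C (1 / 2 : R) * X) * (1 - X) ^ (k - 1) *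
        (C (g i) * (X ^ (2 * i) * oneSubZPow R (-i)))
        = X ^ (2 * i) * (C (g i) * ((1 - C (1 / 2 : R) * X) * ((1 - X) ^ (k - 1) *
          oneSubZPow R (-i)))) := by ring
    rw [this, coeff_X_pow_mul']
    split_ifs with hle
    -- For i < k the remaining factor (1-X/2)(1-X)^r has degree r + 1, below the required 2r + 2.
    · obtain ⟨r, rfl⟩ : ∃ r, k = i + (r + 1) := ⟨k - i - 1, by omega⟩
      rw [← oneSubZPow_natCast, ← oneSubZPow_add,
        show ((i + (r + 1) - 1 : ℕ) : ℤ) + -i = (r : ℤ) by omega,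
        show 2 * (i + (r + 1)) - 2 * i = 2 * r + 1 + 1 by omega, coeff_C_mul, sub_mul, one_mul,
        map_sub, mul_assoc, coeff_C_mul, mul_comm X, coeff_succ_mul_X, coeff_oneSubZPow_natCast,
        coeff_oneSubZPow_natCast, Nat.choose_eq_zero_of_lt (by omega),
        Nat.choose_eq_zero_of_lt (by omega)]
      simp
    · rfl
  · intro hn; simp [hk] at hn

end PowerSeries

/-! ### The binomial matrix -/

section BinomialMatrix

open PowerSeries

/-- `(1 + X)^m + (1 + X)^{-m}` is a polynomial of degree `m`, monic for `m ≠ 0`, in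
`X ^ 2 / (1 + X)`. -/
theorem exists_polynomial_binomialSeries_add_neg (m : ℕ) :
    ∃ D : Polynomial ℤ, (∀ j, m < j → D.coeff j = 0) ∧ (m ≠ 0 → D.coeff m = 1) ∧
      Polynomial.aeval (X ^ 2 * binomialSeries ℤ (-1 : ℤ)) D =
        binomialSeries ℤ (m : ℤ) + binomialSeries ℤ (-m : ℤ) := by
  have hinv : (1 + X) * binomialSeries ℤ (-1 : ℤ) = 1 := by
    have := binomialSeries_add (A := ℤ) (1 : ℤ) (-1)
    rw [show (1 : ℤ) + -1 = 0 by norm_num, binomialSeries_zero] at this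
    rwa [show (1 : ℤ) = (1 : ℕ) by norm_num, binomialSeries_nat, pow_one, eq_comm] at this
  have h1 : binomialSeries ℤ (1 : ℤ) = 1 + X := by
    simpa using (binomialSeries_nat (R := ℤ) (A := ℤ) 1)
  have hC : Polynomial.aeval (X ^ 2 * binomialSeries ℤ (-1 : ℤ)) (Polynomial.C (2 : ℤ)) = 2 := by
    rw [Polynomial.aeval_C]; simp
  induction m using Nat.twoStepInduction with
  | zero =>
    refine ⟨Polynomial.C 2, fun j hj => ?_, by simp, ?_⟩
    · exact Polynomial.coeff_C_of_ne_zero (by omega)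
    · rw [hC]; simp [one_add_one_eq_two]
  | one =>
    refine ⟨Polynomial.X + Polynomial.C 2, fun j hj => ?_, fun _ => ?_, ?_⟩
    · rw [Polynomial.coeff_add, Polynomial.coeff_X, Polynomial.coeff_C_of_ne_zero (by omega)]
      simp; omega
    · rw [Polynomial.coeff_add, Polynomial.coeff_X, Polynomial.coeff_C_of_ne_zero (by omega)]
      simp
    · simp only [map_add, Polynomial.aeval_X, hC, Nat.cast_one, h1]
      linear_combination (X - 1) * hinv
  | more m ih0 ih1 =>
    obtain ⟨D0, h00, -, h02⟩ := ih0
    obtain ⟨D1, h10, h11, h12⟩ := ih1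
    -- The Chebyshev recursion for q^m + q^(-m) with q = 1 + X, since q + q^(-1) = 2 + X^2/(1+X).
    refine ⟨(Polynomial.X + Polynomial.C 2) * D1 - D0, fun j hj => ?_, fun _ => ?_, ?_⟩
    · obtain ⟨j, rfl⟩ : ∃ i, j = i + 1 := ⟨j - 1, by omega⟩
      rw [Polynomial.coeff_sub, add_mul, Polynomial.coeff_add, Polynomial.coeff_X_mul,
        Polynomial.coeff_C_mul, h10 j (by omega), h10 (j + 1) (by omega), h00 _ (by omega)]
      simp
    · rw [Polynomial.coeff_sub, add_mul, Polynomial.coeff_add,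
        show m + 2 = (m + 1) + 1 by rfl, Polynomial.coeff_X_mul,
        Polynomial.coeff_C_mul, h11 (by omega), h10 (m + 1 + 1) (by omega), h00 _ (by omega)]
      simp
    · simp only [map_sub, map_mul, map_add, Polynomial.aeval_X, hC, h12, h02]
      have e1 : ((m + 1 : ℕ) : ℤ) = m + 1 := by push_cast; ring
      have e2 : ((m + 2 : ℕ) : ℤ) = m + 1 + 1 := by push_cast; ring
      rw [e1, e2, show (-((m : ℤ) + 1 + 1)) = -m + -1 + -1 by ring,
        show (-((m : ℤ) + 1)) = -m + -1 by ring]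
      simp only [binomialSeries_add, h1]
      linear_combination ((binomialSeries ℤ (m : ℤ)) * ((1 + X) * (X - 1) + 1)
        + binomialSeries ℤ (-m : ℤ) * (1 + (X - 1) * binomialSeries ℤ (-1 : ℤ))) * hinv

/-- The matrix collects the coefficients of X^(2k) in (1+X)^m + (1+X)^(-m). Writing these series as
polynomials in t = X^2/(1+X) factors it as T * U: T holds the coefficients of monic polynomials of
degree m, and U those of the powers t^j, which start at X^(2j). Both are unitriangular. -/
theorem binomMatrix_det (l : ℕ) : (binomMatrix l).det = 1 := by
  choose D hD0 hD1 hD2 using exists_polynomial_binomialSeries_add_neg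
  let T : Matrix (Fin l) (Fin l) ℤ := Matrix.of fun m j => (D (m + 1)).coeff (j + 1)
  let U : Matrix (Fin l) (Fin l) ℤ := Matrix.of fun j k =>
    coeff (2 * ((k : ℕ) + 1)) ((X ^ 2 * binomialSeries ℤ (-1 : ℤ)) ^ ((j : ℕ) + 1))
  have hU (a b : ℕ) : coeff (2 * b) ((X ^ 2 * binomialSeries ℤ (-1 : ℤ)) ^ a) =
      if a ≤ b then coeff (2 * b - 2 * a) (binomialSeries ℤ (-1 : ℤ) ^ a) else 0 := by
    rw [mul_pow, ← pow_mul, coeff_X_pow_mul']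
    congr 1
    simp
  have hMTU : binomMatrix l = T * U := by
    ext m k
    have key := congrArg (coeff (2 * ((k : ℕ) + 1))) (hD2 (m + 1))
    have hdeg : (D (m + 1)).natDegree < l + 1 := by
      refine Nat.lt_succ_of_le ?_
      rw [Polynomial.natDegree_le_iff_coeff_eq_zero]
      intro N hN
      exact hD0 _ _ (by have := m.2; omega)
    rw [Polynomial.aeval_eq_sum_range' hdeg, map_sum, Finset.sum_range_succ'] at key
    simp only [binomMatrix, Matrix.of_apply, Matrix.mul_apply, T, U]
    rw [Finset.sum_range] at key
    simp only [map_add, binomialSeries_coeff, smul_eq_mul, mul_one, pow_zero,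
      PowerSeries.coeff_smul] at key
    rw [PowerSeries.coeff_one, if_neg (by omega), mul_zero, add_zero] at key
    rw [key]
    push_cast
    rfl
  rw [hMTU, Matrix.det_mul, Matrix.det_of_isLowerTriangular T,
    Matrix.det_of_isUpperTriangular (M := U)]
  · have h1 : ∀ i : Fin l, T i i = 1 := fun i => hD1 _ (by omega)
    have h2 : ∀ i : Fin l, U i i = 1 := fun i => by
      simp only [U, Matrix.of_apply, hU, le_refl, if_true, Nat.sub_self]
      simp
    simp [h1, h2]
  · intro i j hij
    simp only [U, Matrix.of_apply, hU]
    rw [if_neg]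
    have : (j : ℕ) < i := hij
    omega
  · intro i j hij
    have : (i : ℕ) < j := hij
    exact hD0 _ _ (by omega)

end BinomialMatrix

/-! ### Palindromic polynomials -/

open PowerSeries in
/-- A palindromic polynomial of degree at most `2 N` is a combination of
`(1 - X) ^ (2 k) X ^ (N - k)`. -/
theorem exists_expansion_of_palindromic {R : Type*} [CommRing R] (N : ℕ) :
    ∀ P : PowerSeries R, (∀ n, 2 * N < n → coeff n P = 0) →
      (∀ i j, i + j = 2 * N → coeff i P = coeff j P) →
      ∃ g : ℕ → R, P = ∑ k ∈ Finset.range (N + 1), C (g k) * ((1 - X) ^ (2 * k) * X ^ (N - k)) := by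
  induction N with
  | zero =>
    intro P h0 _
    refine ⟨fun _ => coeff 0 P, ?_⟩
    ext n
    rcases Nat.eq_zero_or_pos n with rfl | hn
    · simp
    · rw [h0 n (by omega)]
      simp [coeff_C, hn.ne']
  | succ N ih =>
    intro P h0 hs
    -- Removing the constant term by a palindromic polynomial also removes the top coefficient, so Q
    -- / X is palindromic for N.
    set Q : PowerSeries R := P - C (coeff 0 P) * (1 - X) ^ (2 * (N + 1)) with hQ
    have hc : ∀ n, coeff n ((1 - X) ^ (2 * (N + 1)) : PowerSeries R)
        = (-1) ^ n * ((2 * (N + 1)).choose n : R) := fun n => by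
      rw [← oneSubZPow_natCast, coeff_oneSubZPow_natCast]
    have hQ0 : ∀ n, 2 * (N + 1) < n → coeff n Q = 0 := by
      intro n hn
      rw [hQ, map_sub, coeff_C_mul, hc, h0 n hn, Nat.choose_eq_zero_of_lt hn]
      simp
    have hQs : ∀ i j, i + j = 2 * (N + 1) → coeff i Q = coeff j Q := by
      intro i j hij
      rw [hQ, map_sub, map_sub, coeff_C_mul, coeff_C_mul, hc, hc, hs i j hij,
        Nat.choose_symm_of_eq_add (hij.symm.trans (add_comm i j))]
      have : (-1 : R) ^ i = (-1) ^ j := by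
        rw [neg_one_pow_eq_pow_mod_two, neg_one_pow_eq_pow_mod_two (n := j),
          show i % 2 = j % 2 by omega]
      rw [this]
    have hQz : coeff 0 Q = 0 := by
      rw [hQ, map_sub, coeff_C_mul, hc]; simp
    obtain ⟨Q', hQ'⟩ : ∃ Q', Q = X * Q' := X_dvd_iff.2 (by simpa using hQz)
    have hcoef : ∀ n, coeff n Q' = coeff (n + 1) Q := fun n => by rw [hQ', coeff_succ_X_mul]
    obtain ⟨g, hg⟩ := ih Q' (fun n hn => by
        rw [hcoef]
        rcases (show 2 * (N + 1) = n + 1 ∨ 2 * (N + 1) < n + 1 by omega) with h | h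
        · rw [hQs (n + 1) 0 (by omega), hQz]
        · exact hQ0 _ h) (fun i j hij => by rw [hcoef, hcoef]; exact hQs _ _ (by omega))
    refine ⟨fun k => if k = N + 1 then coeff 0 P else g k, ?_⟩
    rw [Finset.sum_range_succ]
    have : P = X * Q' + C (coeff 0 P) * (1 - X) ^ (2 * (N + 1)) := by rw [← hQ', hQ]; ring
    conv_lhs => rw [this, hg, Finset.mul_sum]
    congr 1
    · refine Finset.sum_congr rfl fun k hk => ?_
      have hk' : k < N + 1 := Finset.mem_range.1 hk
      simp only [if_neg (show k ≠ N + 1 by omega)]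
      rw [show N + 1 - k = (N - k) + 1 by omega, pow_succ]
      ring
    · simp

/-! ### Values of rational functions -/

section Values

open Polynomial

/-- The rational function `f` is regular at `c`, with value `v`. -/
def HasVal (f : RatFunc ℚ) (c v : ℂ) : Prop :=
  ∃ p q : ℚ[X], aeval c q ≠ 0 ∧ f = algebraMap ℚ[X] (RatFunc ℚ) p / algebraMap ℚ[X] (RatFunc ℚ) q ∧
    v = aeval c p / aeval c q

namespace HasVal

variable {f g : RatFunc ℚ} {c v w : ℂ}

theorem algebraMap_ne_zero {q : ℚ[X]} (hq : aeval c q ≠ 0) :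
    algebraMap ℚ[X] (RatFunc ℚ) q ≠ 0 :=
  RatFunc.algebraMap_ne_zero fun h => hq (by simp [h])

theorem poly (p : ℚ[X]) (c : ℂ) : HasVal (algebraMap ℚ[X] (RatFunc ℚ) p) c (aeval c p) :=
  ⟨p, 1, by simp, by simp, by simp⟩

theorem const (r : ℚ) (c : ℂ) : HasVal (algebraMap ℚ (RatFunc ℚ) r) c (r : ℂ) := by
  have h := poly (C r) c
  rw [aeval_C, RatFunc.algebraMap_C, eq_ratCast (algebraMap ℚ ℂ), eq_ratCast (RatFunc.C)] at h
  rwa [eq_ratCast]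

theorem zero (c : ℂ) : HasVal 0 c 0 := by simpa using const 0 c

theorem add (hf : HasVal f c v) (hg : HasVal g c w) : HasVal (f + g) c (v + w) := by
  obtain ⟨p, q, hq, rfl, rfl⟩ := hf
  obtain ⟨p', q', hq', rfl, rfl⟩ := hg
  refine ⟨p * q' + q * p', q * q', by simp [hq, hq'], ?_, ?_⟩
  · rw [div_add_div _ _ (algebraMap_ne_zero hq) (algebraMap_ne_zero hq')]
    simp
  · rw [div_add_div _ _ hq hq']
    simp

theorem mul (hf : HasVal f c v) (hg : HasVal g c w) : HasVal (f * g) c (v * w) := by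
  obtain ⟨p, q, hq, rfl, rfl⟩ := hf
  obtain ⟨p', q', hq', rfl, rfl⟩ := hg
  refine ⟨p * p', q * q', by simp [hq, hq'], ?_, ?_⟩
  · rw [div_mul_div_comm]; simp
  · rw [div_mul_div_comm]; simp

theorem inv (hf : HasVal f c v) (hv : v ≠ 0) : HasVal f⁻¹ c v⁻¹ := by
  obtain ⟨p, q, hq, rfl, rfl⟩ := hf
  refine ⟨q, p, fun h => hv (by simp [h]), by rw [inv_div], by rw [inv_div]⟩

theorem sum {ι : Type*} (s : Finset ι) {F : ι → RatFunc ℚ} {G : ι → ℂ}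
    (h : ∀ i ∈ s, HasVal (F i) c (G i)) : HasVal (∑ i ∈ s, F i) c (∑ i ∈ s, G i) := by
  classical
  induction s using Finset.induction_on with
  | empty => simpa using zero c
  | insert a s ha ih =>
    rw [Finset.sum_insert ha, Finset.sum_insert ha]
    exact (h a (by simp)).add (ih fun i hi => h i (by simp [hi]))

/-- The reduced denominator divides every denominator of f, so one fraction with denominator nonzero
at c is enough. -/
theorem isRegularAt (h : HasVal f c v) : IsRegularAt f c := by
  obtain ⟨p, q, hq, rfl, rfl⟩ := h
  obtain ⟨r, hr⟩ := RatFunc.denom_div_dvd p q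
  intro h0
  apply hq
  rw [hr, map_mul, h0, zero_mul]

theorem evalC_eq (h : HasVal f c v) : evalC f c = v := by
  have hreg := h.isRegularAt
  obtain ⟨p, q, hq, hf, rfl⟩ := h
  have hq0 := algebraMap_ne_zero hq
  have hd0 : algebraMap ℚ[X] (RatFunc ℚ) f.denom ≠ 0 := algebraMap_ne_zero hreg
  have key : f.num * q = p * f.denom := by
    apply RatFunc.algebraMap_injective ℚ
    rw [map_mul, map_mul]
    have := (RatFunc.num_div_denom f).trans hf
    rwa [div_eq_div_iff hd0 hq0] at this
  have key' := congrArg (aeval c) key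
  rw [map_mul, map_mul] at key'
  rw [evalC, RatFunc.eval, ← aeval_def, ← aeval_def, div_eq_div_iff hreg hq, key']

theorem unique (h : HasVal f c v) (h' : HasVal f c w) : v = w := h.evalC_eq.symm.trans h'.evalC_eq

theorem coeff_map_mul (Q : PowerSeries ℚ) {S : PowerSeries (RatFunc ℚ)} {S' : PowerSeries ℂ}
    {N : ℕ} (h : ∀ n ≤ N, HasVal (PowerSeries.coeff n S) c (PowerSeries.coeff n S')) :
    HasVal (PowerSeries.coeff N (PowerSeries.map (algebraMap ℚ (RatFunc ℚ)) Q * S)) c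
      (PowerSeries.coeff N (PowerSeries.map (algebraMap ℚ ℂ) Q * S')) := by
  rw [PowerSeries.coeff_mul, PowerSeries.coeff_mul]
  refine sum _ fun ij hij => ?_
  rw [PowerSeries.coeff_map, PowerSeries.coeff_map]
  refine (const _ c).mul (h _ ?_)
  have := Finset.HasAntidiagonal.mem_antidiagonal.1 hij
  omega

/-- Cramer's rule: the adjugate and the determinant are polynomial and commute with specialisation,
so the only possible poles are zeros of the determinant. -/
theorem matrix_inv {ι : Type*} [Fintype ι] [DecidableEq ι] (M : Matrix ι ι ℚ[X]) (c : ℂ)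
    (h : (M.map (aeval c)).det ≠ 0) (i j : ι) :
    HasVal ((M.map (algebraMap ℚ[X] (RatFunc ℚ)))⁻¹ i j) c ((M.map (aeval c))⁻¹ i j) := by
  have h1 : M.map (aeval c) = (aeval c : ℚ[X] →ₐ[ℚ] ℂ).toRingHom.mapMatrix M := rfl
  have h2 : M.map (algebraMap ℚ[X] (RatFunc ℚ)) = (algebraMap ℚ[X] (RatFunc ℚ)).mapMatrix M := rfl
  rw [h1] at h ⊢
  rw [h2, Matrix.inv_def, Matrix.inv_def, Ring.inverse_eq_inv', Ring.inverse_eq_inv',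
    ← RingHom.map_adjugate, ← RingHom.map_adjugate, ← RingHom.map_det, ← RingHom.map_det]
  rw [← RingHom.map_det] at h
  simp only [Matrix.smul_apply, smul_eq_mul, RingHom.mapMatrix_apply, Matrix.map_apply]
  exact ((poly _ c).inv h).mul (poly _ c)

end HasVal

end Values

/-! ### Vacuum expectation values -/

section Vev

/-- Vacuum expectation values of modes with `[J(m), J(n)] = s (m - n) J(m + n) + t (m ^ 3 - m) δ`. -/
def vevGen {R : Type*} [CommRing R] (s t : R) : List ℤ → R
  | [] => 1
  | n :: w =>
    if n ≤ 1 then 0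
    else ∑ i : Fin w.length,
      (s * ((n : R) - (w.get i : R)) * vevGen s t (w.set i (n + w.get i))
        + if n + w.get i = 0 then t * ((n : R) ^ 3 - n) * vevGen s t (w.eraseIdx i) else 0)
  termination_by w => w.length
  decreasing_by
    all_goals simp_wf
    all_goals grind

theorem virVev_eq_vevGen {K : Type*} [Field K] (c : K) (w : List ℤ) :
    virVev c w = vevGen 1 (c / 12) w := by
  -- The two recursions branch identically, so one induction principle serves both.
  induction w using virVev.induct with
  | case1 => simp [virVev, vevGen]
  | case2 n w h => simp [virVev, vevGen, h]
  | case3 n w h ih1 ih2 =>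
    rw [virVev, vevGen, if_neg h, if_neg h]
    refine Finset.sum_congr rfl fun i _ => ?_
    rw [ih1, ih2, one_mul]

theorem map_vevGen {R S : Type*} [CommRing R] [CommRing S] (f : R →+* S) (s t : R) (w : List ℤ) :
    f (vevGen s t w) = vevGen (f s) (f t) w := by
  induction w using virVev.induct with
  | case1 => simp [vevGen]
  | case2 n w h => simp [vevGen, h]
  | case3 n w h ih1 ih2 =>
    rw [vevGen, vevGen, if_neg h, if_neg h, map_sum]
    refine Finset.sum_congr rfl fun i _ => ?_
    simp only [map_add, map_mul, ih1, ih2, apply_ite f, map_sub, map_pow, map_intCast, map_zero]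

/-- Replacing each J by eJ multiplies the structure constants by e and the central term by e^2.
Accordingly the first kind of term shortens the list by one mode, the second by two. -/
theorem vevGen_scale {R : Type*} [CommRing R] (e s t : R) (w : List ℤ) :
    vevGen (e * s) (e ^ 2 * t) w = e ^ w.length * vevGen s t w := by
  induction w using virVev.induct with
  | case1 => simp [vevGen]
  | case2 n w h => simp [vevGen, h]
  | case3 n w h ih1 ih2 =>
    rw [vevGen, vevGen, if_neg h, if_neg h, Finset.mul_sum]
    refine Finset.sum_congr rfl fun i _ => ?_
    rw [ih1, ih2, List.length_set, List.length_eraseIdx_of_lt i.2, List.length_cons]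
    have : e ^ w.length = e ^ (w.length - 1) * e := by
      rw [← pow_succ, Nat.sub_add_cancel (by have := i.2; omega)]
    split_ifs
    · linear_combination (e * t * ((n : R) ^ 3 - n) * vevGen s t (w.eraseIdx i)) * (-this)
    · ring

end Vev

/-- The positive modes labelled by `I` followed by the negative modes labelled by `J`. -/
def modeList (I J : List ℕ) : List ℤ :=
  I.map (Nat.cast : ℕ → ℤ) ++ J.map (fun k : ℕ => -(k : ℤ))

theorem virGram_apply {K : Type*} [Field K] (c : K) (n : ℕ) (I J : VacPartition n) :
    virGram c n I J = virVev c (modeList I.list.reverse J.list) := by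
  simp [virGram, modeList, List.map_eq_flatMap, List.flatMap_assoc]

/-! ### Values of the coefficients -/

section BlockValues

open Polynomial

/-- The coefficient of the vacuum block at a complex central charge. -/
noncomputable def blockVal (c : ℂ) (l n : ℕ) : ℂ :=
  ∑ I : VacPartition n, ∑ J : VacPartition n,
    (casimirRho l I.list : ℂ) * (virGram c n)⁻¹ I J * (casimirRho l J.list : ℂ)

/-- The Gram matrix as a matrix of polynomials in the central charge. -/
noncomputable def virGramPoly (n : ℕ) : Matrix (VacPartition n) (VacPartition n) ℚ[X] :=
  Matrix.of fun I J =>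
    vevGen 1 (C (1 / 12) * X) (modeList I.list.reverse J.list)

theorem virGramPoly_map_algebraMap (n : ℕ) :
    (virGramPoly n).map (algebraMap ℚ[X] (RatFunc ℚ)) = virGram (RatFunc.X : RatFunc ℚ) n := by
  ext I J
  simp only [Matrix.map_apply, virGramPoly, virGram_apply, Matrix.of_apply]
  rw [virVev_eq_vevGen, map_vevGen]
  congr 1
  · simp
  · rw [map_mul, RatFunc.algebraMap_X, RatFunc.algebraMap_C]
    simp
    ring

theorem virGramPoly_map_aeval (c : ℂ) (n : ℕ) :
    (virGramPoly n).map (aeval c) = virGram c n := by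
  ext I J
  simp only [Matrix.map_apply, virGramPoly, virGram_apply, Matrix.of_apply]
  rw [virVev_eq_vevGen]
  refine (map_vevGen (aeval c : ℚ[X] →ₐ[ℚ] ℂ).toRingHom _ _ _).trans ?_
  congr 1
  · simp
  · simp
    ring

/-- The Gram matrices over ℚ(c) and over ℂ are two specialisations of `virGramPoly`, so
`HasVal.matrix_inv` applies entrywise. -/
theorem hasVal_blockCoeff {c : ℂ} {n : ℕ} (l : ℕ) (h : (virGram c n).det ≠ 0) :
    HasVal (blockCoeff l n) c (blockVal c l n) := by
  have hint : ∀ z : ℤ, HasVal (z : RatFunc ℚ) c (z : ℂ) := fun z => by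
    simpa using HasVal.const (z : ℚ) c
  refine HasVal.sum _ fun I _ => HasVal.sum _ fun J _ => ((hint _).mul ?_).mul (hint _)
  rw [← virGramPoly_map_algebraMap, ← virGramPoly_map_aeval]
  exact HasVal.matrix_inv _ _ (by rwa [virGramPoly_map_aeval]) _ _

theorem PowerSeries.map_oneSubZPow {R S : Type*} [CommRing R] [CommRing S] (f : R →+* S) (r : ℤ) :
    PowerSeries.map f (PowerSeries.oneSubZPow R r) = PowerSeries.oneSubZPow S r := by
  ext n
  simp [PowerSeries.coeff_oneSubZPow]

theorem PowerSeries.inv_one_sub_X_pow {K : Type*} [Field K] (n : ℕ) :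
    ((1 - PowerSeries.X : PowerSeries K)⁻¹) ^ n = PowerSeries.oneSubZPow K (-n) := by
  have h : (1 - PowerSeries.X : PowerSeries K)⁻¹ = PowerSeries.oneSubZPow K (-1) := by
    rw [PowerSeries.inv_eq_iff_mul_eq_one (by simp)]
    have := PowerSeries.oneSubZPow_natCast (R := K) 1
    rw [pow_one] at this
    rw [← this, ← PowerSeries.oneSubZPow_add]
    simp [PowerSeries.oneSubZPow_zero]
  rw [h, PowerSeries.oneSubZPow_mul_pow]
  congr 1
  ring

/-- The value of `vCoeff l k` at a complex central charge. -/
noncomputable def vVal (c : ℂ) (l k : ℕ) : ℂ :=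
  PowerSeries.coeff (2 * k) ((1 - PowerSeries.C (1 / 2 : ℂ) * PowerSeries.X) *
      (1 - PowerSeries.X) ^ (k - 1) * PowerSeries.mk (blockVal c l))

/-- The value of `wCoeff l j` at a complex central charge. -/
noncomputable def wVal (c : ℂ) (l j : ℕ) : ℂ :=
  PowerSeries.coeff j ((1 + PowerSeries.X) *
      PowerSeries.oneSubZPow ℂ (-((2 * l + 1 - 2 * j : ℕ) : ℤ)) * PowerSeries.mk (blockVal c l))

theorem hasVal_vCoeff {c : ℂ} {l k : ℕ} (h : ∀ n ≤ 2 * k, (virGram c n).det ≠ 0) :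
    HasVal (vCoeff l k) c (vVal c l k) := by
  have := HasVal.coeff_map_mul (c := c) ((1 - PowerSeries.C (1 / 2 : ℚ) * PowerSeries.X) *
    (1 - PowerSeries.X) ^ (k - 1)) (S := blockSeries l) (S' := PowerSeries.mk (blockVal c l))
    (N := 2 * k) (fun n hn => by
      rw [blockSeries, PowerSeries.coeff_mk, PowerSeries.coeff_mk]
      exact hasVal_blockCoeff l (h n hn))
  rw [vCoeff, vVal]
  convert this using 3 <;> simp

theorem hasVal_wCoeff {c : ℂ} {l j : ℕ} (h : ∀ n ≤ j, (virGram c n).det ≠ 0) :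
    HasVal (wCoeff l j) c (wVal c l j) := by
  have := HasVal.coeff_map_mul (c := c) ((1 + PowerSeries.X) *
      PowerSeries.oneSubZPow ℚ (-((2 * l + 1 - 2 * j : ℕ) : ℤ)))
    (S := blockSeries l) (S' := PowerSeries.mk (blockVal c l))
    (N := j) (fun n hn => by
      rw [blockSeries, PowerSeries.coeff_mk, PowerSeries.coeff_mk]
      exact hasVal_blockCoeff l (h n hn))
  rw [wCoeff, wVal, PowerSeries.inv_one_sub_X_pow]
  convert this using 3
  · rw [map_mul, PowerSeries.map_oneSubZPow]; simp
  · rw [map_mul, PowerSeries.map_oneSubZPow]; simp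

end BlockValues

/-! ### The free field limit of the Gram matrix -/

section FreeField

theorem vevGen_zero_cons {R : Type*} [CommRing R] (t : R) {n : ℤ} (hn : ¬ n ≤ 1) (w : List ℤ) :
    vevGen 0 t (n :: w) = ∑ i : Fin w.length,
      if n + w.get i = 0 then t * ((n : R) ^ 3 - n) * vevGen 0 t (w.eraseIdx i) else 0 := by
  rw [vevGen, if_neg hn]
  simp

/-- Wick's theorem for the free field vacuum expectation values. -/
theorem vevGen_zero_wick (I : List ℕ) : ∀ J : List ℕ, (∀ i ∈ I, 2 ≤ i) →
    (I.Perm J → 0 < vevGen (0 : ℝ) (1 / 12) (modeList I J)) ∧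
    (¬ I.Perm J → vevGen (0 : ℝ) (1 / 12) (modeList I J) = 0) := by
  induction I with
  | nil =>
    intro J _
    cases J with
    | nil => simp [vevGen, modeList]
    | cons j J =>
      refine ⟨fun h => by simp at h, fun _ => ?_⟩
      simp only [modeList, List.map_nil, List.nil_append, List.map_cons]
      rw [vevGen, if_pos (by omega)]
  | cons n I ih =>
    intro J hI
    have hn : 2 ≤ n := hI n (by simp)
    have hI' : ∀ i ∈ I, 2 ≤ i := fun i hi => hI i (by simp [hi])
    have hcoef : (0 : ℝ) < 1 / 12 * (((n : ℤ) : ℝ) ^ 3 - (n : ℤ)) := by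
      have : (2 : ℝ) ≤ n := by exact_mod_cast hn
      push_cast
      nlinarith [mul_pos (show (0 : ℝ) < n by linarith) (show (0 : ℝ) < n - 1 by linarith)]
    rw [show modeList (n :: I) J = (n : ℤ) :: modeList I J from rfl,
      vevGen_zero_cons _ (by omega)]
    set w : List ℤ := modeList I J with hw
    have hlen : w.length = I.length + J.length := by simp [hw, modeList]
    -- Modes from I are positive, so the leading mode can only contract with a mode from J of the
    -- same label.
    have herase : ∀ i : Fin w.length, (n : ℤ) + w.get i = 0 →
        ∃ (j : ℕ) (hj : j < J.length), J[j] = n ∧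
          w.eraseIdx i = modeList I (J.eraseIdx j) := by
      intro i hi
      rcases lt_or_ge (i : ℕ) I.length with hlt | hge
      · exfalso
        have : w.get i = (I[(i : ℕ)] : ℤ) := by
          simp [hw, modeList, hlt]
        rw [this] at hi
        omega
      · refine ⟨i - I.length, by have := i.2; omega, ?_, ?_⟩
        · have : w.get i = -(J[(i : ℕ) - I.length]'(by have := i.2; omega) : ℤ) := by
            simp [hw, modeList, List.getElem_append, not_lt.2 hge]
          rw [this] at hi
          omega
        · change (modeList I J).eraseIdx i = _
          rw [modeList, List.eraseIdx_append_of_length_le (by simpa using hge), List.eraseIdx_map]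
          simp [modeList]
    have hperm : ∀ (j : ℕ) (hj : j < J.length), J[j] = n →
        (((n :: I).Perm J) ↔ I.Perm (J.eraseIdx j)) := by
      intro j hj hjn
      have h1 : (n :: J.eraseIdx j).Perm J := by
        rw [← hjn]; exact List.getElem_cons_eraseIdx_perm hj
      exact ⟨fun h => List.perm_cons n |>.1 (h.trans h1.symm), fun h => (h.cons n).trans h1⟩
    constructor
    · intro hp
      -- All contractions contribute nonnegatively because n^3 - n > 0 for n ≥ 2, and a contraction
      -- exists because n occurs in J.
      apply Finset.sum_pos'
      · intro i _
        split_ifs with hi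
        · obtain ⟨j, hj, hjn, he⟩ := herase i hi
          rw [he]
          exact (mul_pos hcoef ((ih _ hI').1 ((hperm j hj hjn).1 hp))).le
        · exact le_rfl
      · have hmem : n ∈ J := hp.subset (by simp)
        obtain ⟨j, hj, hjn⟩ := List.getElem_of_mem hmem
        refine ⟨⟨I.length + j, by omega⟩, Finset.mem_univ _, ?_⟩
        have hget : (n : ℤ) + w.get ⟨I.length + j, by omega⟩ = 0 := by
          simp [hw, modeList, hjn]
        rw [if_pos hget]
        obtain ⟨j', hj', hjn', he⟩ := herase _ hget
        rw [he]
        exact mul_pos hcoef ((ih _ hI').1 ((hperm j' hj' hjn').1 hp))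
    · intro hp
      apply Finset.sum_eq_zero
      intro i _
      split_ifs with hi
      · obtain ⟨j, hj, hjn, he⟩ := herase i hi
        rw [he, (ih _ hI').2 (fun h => hp ((hperm j hj hjn).2 h)), mul_zero]
      · rfl

namespace VacPartition

variable {n : ℕ}

theorem mem_list (P : VacPartition n) (k : ℕ) : k ∈ P.list ↔ k ∈ P.1.parts :=
  Multiset.mem_sort _

theorem two_le (P : VacPartition n) {k : ℕ} (hk : k ∈ P.list) : 2 ≤ k := by
  rw [mem_list] at hk
  have h0 := P.1.parts_pos hk
  have h1 : k ≠ 1 := fun h => P.2 (h ▸ hk)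
  omega

theorem coe_list (P : VacPartition n) : (P.list : Multiset ℕ) = P.1.parts :=
  Multiset.sort_eq _ _

theorem sum_list (P : VacPartition n) : P.list.sum = n := by
  rw [← Multiset.sum_coe, coe_list, P.1.parts_sum]

theorem eq_of_perm {P Q : VacPartition n} (h : P.list.Perm Q.list) : P = Q := by
  apply Subtype.ext
  apply Nat.Partition.ext
  rw [← coe_list, ← coe_list]
  exact Multiset.coe_eq_coe.2 h

theorem length_pos (P : VacPartition n) (hn : 1 ≤ n) : 1 ≤ P.list.length := by
  rcases Nat.eq_zero_or_pos P.list.length with h | h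
  · have := P.sum_list
    rw [List.length_eq_zero_iff.1 h] at this
    simp at this
    omega
  · exact h

theorem list_eq_singleton (P : VacPartition n) (h : P.list.length = 1) : P.list = [n] := by
  obtain ⟨a, ha⟩ := List.length_eq_one_iff.1 h
  have := P.sum_list
  rw [ha] at this
  simp at this
  rw [ha, this]

end VacPartition

/-- The Gram matrix of the modes rescaled by `e`, at central charge `e ^ (-2)`. -/
noncomputable def scaledGram (e : ℂ) (n : ℕ) : Matrix (VacPartition n) (VacPartition n) ℂ :=
  Matrix.of fun I J => vevGen e (1 / 12)
    (modeList I.list.reverse J.list)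

theorem continuous_scaledGram (n : ℕ) : Continuous fun e => scaledGram e n := by
  refine continuous_matrix fun I J => ?_
  simp only [scaledGram, Matrix.of_apply]
  set w := modeList I.list.reverse J.list
  have : (fun e : ℂ => vevGen e (1 / 12) w) = fun e =>
      (vevGen (Polynomial.X : Polynomial ℂ) (Polynomial.C (1 / 12)) w).eval e := by
    ext e
    rw [← Polynomial.coe_evalRingHom, map_vevGen]
    simp
  rw [this]
  exact Polynomial.continuous _

theorem scaledGram_zero_apply (n : ℕ) (I J : VacPartition n) :
    scaledGram 0 n I J = ((vevGen (0 : ℝ) (1 / 12)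
      (modeList I.list.reverse J.list) : ℝ) : ℂ) := by
  have := map_vevGen Complex.ofRealHom 0 (1 / 12)
    (modeList I.list.reverse J.list)
  simp only [Complex.ofRealHom_eq_coe] at this
  rw [this]
  simp [scaledGram]

theorem scaledGram_zero (n : ℕ) :
    scaledGram 0 n = Matrix.diagonal fun I => scaledGram 0 n I I := by
  ext I J
  rcases eq_or_ne I J with rfl | h
  · simp
  · rw [Matrix.diagonal_apply_ne _ h, scaledGram_zero_apply,
      (vevGen_zero_wick _ _ fun i hi => I.two_le (List.mem_reverse.1 hi)).2, Complex.ofReal_zero]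
    exact fun hp => h (VacPartition.eq_of_perm ((List.reverse_perm _).symm.trans hp))

theorem scaledGram_zero_diag_ne (n : ℕ) (I : VacPartition n) : scaledGram 0 n I I ≠ 0 := by
  rw [scaledGram_zero_apply, Complex.ofReal_ne_zero]
  exact ((vevGen_zero_wick _ _ fun i hi => I.two_le (List.mem_reverse.1 hi)).1
    (List.reverse_perm _)).ne'

theorem det_scaledGram_zero_ne (n : ℕ) : (scaledGram 0 n).det ≠ 0 := by
  rw [scaledGram_zero, Matrix.det_diagonal]
  exact Finset.prod_ne_zero_iff.2 fun I _ => scaledGram_zero_diag_ne n I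

theorem inv_scaledGram_zero (n : ℕ) :
    (scaledGram 0 n)⁻¹ = Matrix.diagonal fun I => (scaledGram 0 n I I)⁻¹ := by
  apply Matrix.inv_eq_right_inv
  conv_lhs => enter [1]; rw [scaledGram_zero]
  rw [Matrix.diagonal_mul_diagonal, ← Matrix.diagonal_one]
  congr 1
  ext I
  exact mul_inv_cancel₀ (scaledGram_zero_diag_ne n I)

/-- At c = e^(-2) the rescaled central term is e^2 c/12 = 1/12, free of e. Thus c → ∞ becomes the
regular point e = 0. -/
theorem scaledGram_eq {e : ℂ} (he : e ≠ 0) (n : ℕ) :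
    scaledGram e n = Matrix.diagonal (fun I : VacPartition n => e ^ I.list.length) *
      virGram (e ^ 2)⁻¹ n * Matrix.diagonal (fun I : VacPartition n => e ^ I.list.length) := by
  ext I J
  rw [Matrix.mul_diagonal, Matrix.diagonal_mul]
  simp only [scaledGram, virGram_apply, Matrix.of_apply]
  have h := vevGen_scale e 1 ((e ^ 2)⁻¹ / 12)
    (modeList I.list.reverse J.list)
  rw [virVev_eq_vevGen]
  rw [mul_one, show e ^ 2 * ((e ^ 2)⁻¹ / 12) = 1 / 12 by field_simp] at h
  rw [h]
  simp [modeList, pow_add]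
  ring

theorem det_virGram_ne_of_scaled {e : ℂ} (he : e ≠ 0) {n : ℕ} (h : (scaledGram e n).det ≠ 0) :
    (virGram (e ^ 2)⁻¹ n).det ≠ 0 := by
  intro h0
  rw [scaledGram_eq he, Matrix.det_mul, Matrix.det_mul, h0] at h
  simp at h

theorem inv_virGram_eq {e : ℂ} (he : e ≠ 0) {n : ℕ} (I J : VacPartition n) :
    (virGram (e ^ 2)⁻¹ n)⁻¹ I J =
      e ^ I.list.length * (scaledGram e n)⁻¹ I J * e ^ J.list.length := by
  have hD : (Matrix.diagonal (fun I : VacPartition n => e ^ I.list.length)).det ≠ 0 := by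
    rw [Matrix.det_diagonal]
    exact Finset.prod_ne_zero_iff.2 fun I _ => pow_ne_zero _ he
  have : (virGram (e ^ 2)⁻¹ n)⁻¹ = Matrix.diagonal (fun I : VacPartition n => e ^ I.list.length) *
      (scaledGram e n)⁻¹ * Matrix.diagonal (fun I : VacPartition n => e ^ I.list.length) := by
    rw [scaledGram_eq he, Matrix.mul_inv_rev, Matrix.mul_inv_rev, ← Matrix.mul_assoc,
      Matrix.mul_nonsing_inv _ (isUnit_iff_ne_zero.2 hD), Matrix.one_mul, Matrix.mul_assoc,
      Matrix.nonsing_inv_mul _ (isUnit_iff_ne_zero.2 hD), Matrix.mul_one]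
  rw [this, Matrix.mul_diagonal, Matrix.diagonal_mul]

open Filter Topology

/-- The entry (I, J) of the inverse Gram matrix carries a power of e equal to the total number of
parts. At order e^2 = 1/c only I = J = (n) survives, with ρ_l = l(n-1) and rescaled norm
n(n^2-1)/12; the stated limit is the partial fraction form of 12 l^2 (n-1)/(n(n+1)). -/
theorem tendsto_blockVal (l : ℕ) {n : ℕ} (hn : 1 ≤ n) :
    Tendsto (fun e : ℂ => blockVal (e ^ 2)⁻¹ l n / e ^ 2) (𝓝[≠] 0)
      (𝓝 (12 * l ^ 2 * (2 / (n + 1) - 1 / n))) := by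
  have hinv : ContinuousAt (fun e => (scaledGram e n)⁻¹) 0 := by
    have : (fun e => (scaledGram e n)⁻¹) =
        fun e => (scaledGram e n).det⁻¹ • (scaledGram e n).adjugate := by
      ext e
      rw [Matrix.inv_def, Ring.inverse_eq_inv']
    rw [this]
    have hc := continuous_scaledGram n
    exact (hc.matrix_det.continuousAt.inv₀ (det_scaledGram_zero_ne n)).smul
      hc.matrix_adjugate.continuousAt
  have hlim : Tendsto (fun e : ℂ => ∑ I : VacPartition n, ∑ J : VacPartition n,
      (casimirRho l I.list : ℂ) * (e ^ (I.list.length + J.list.length - 2) *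
        (scaledGram e n)⁻¹ I J) * (casimirRho l J.list : ℂ)) (𝓝[≠] 0)
      (𝓝 (∑ I : VacPartition n, ∑ J : VacPartition n,
      (casimirRho l I.list : ℂ) * ((0 : ℂ) ^ (I.list.length + J.list.length - 2) *
        (scaledGram 0 n)⁻¹ I J) * (casimirRho l J.list : ℂ))) := by
    refine tendsto_nhdsWithin_of_tendsto_nhds ?_
    refine tendsto_finsetSum _ fun I _ => tendsto_finsetSum _ fun J _ => ?_
    refine (tendsto_const_nhds.mul (Tendsto.mul ?_ ?_)).mul tendsto_const_nhds
    · exact (continuous_pow _).tendsto _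
    · exact ((continuous_apply_apply I J).continuousAt.tendsto).comp hinv.tendsto
  have hval : (∑ I : VacPartition n, ∑ J : VacPartition n,
      (casimirRho l I.list : ℂ) * ((0 : ℂ) ^ (I.list.length + J.list.length - 2) *
        (scaledGram 0 n)⁻¹ I J) * (casimirRho l J.list : ℂ)) =
      12 * l ^ 2 * (2 / (n + 1) - 1 / n) := by
    have h1 : ∀ I : VacPartition n, (∑ J : VacPartition n,
      (casimirRho l I.list : ℂ) * ((0 : ℂ) ^ (I.list.length + J.list.length - 2) *
        (scaledGram 0 n)⁻¹ I J) * (casimirRho l J.list : ℂ)) =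
        if I.list = [n] then 12 * (l : ℂ) ^ 2 * (2 / ((n : ℂ) + 1) - 1 / n) else 0 := by
      intro I
      rw [inv_scaledGram_zero, Finset.sum_eq_single I]
      · rw [Matrix.diagonal_apply_eq]
        split_ifs with hI
        · have h2 : 2 ≤ n := I.two_le (by rw [hI]; simp)
          have hn0 : (n : ℂ) ≠ 0 := by exact_mod_cast (by omega : n ≠ 0)
          have hn1 : (n : ℂ) + 1 ≠ 0 := by exact_mod_cast (by omega : n + 1 ≠ 0)
          have hn2 : (n : ℂ) - 1 ≠ 0 := by
            rw [sub_ne_zero]; exact_mod_cast (by omega : n ≠ 1)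
          have hg : scaledGram 0 n I I = 1 / 12 * ((n : ℂ) * ((n - 1) * (n + 1))) := by
            simp only [scaledGram, Matrix.of_apply, hI, List.reverse_singleton, modeList,
              List.map_cons, List.map_nil, List.singleton_append]
            rw [vevGen_zero_cons _ (by omega)]
            simp [vevGen]
            ring
          rw [hg, hI]
          simp [casimirRho]
          field_simp
          ring
        · have hlen : 2 ≤ I.list.length := by
            have h1 := I.length_pos hn
            have h2 : I.list.length ≠ 1 := fun h => hI (I.list_eq_singleton h)
            omega
          rw [zero_pow (by omega)]
          simp
      · intro J _ hJ
        rw [Matrix.diagonal_apply_ne _ hJ.symm]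
        simp
      · simp
    rw [Finset.sum_congr rfl fun I _ => h1 I]
    -- For n = 1 there is no admissible partition, and the limit 2/2 - 1 is zero as well.
    rcases Nat.lt_or_ge 1 n with hn1 | hn1
    · let P : VacPartition n := ⟨Nat.Partition.indiscrete n, by
        rw [Nat.Partition.indiscrete_parts (by omega)]; simp; omega⟩
      have hP : P.list = [n] := by
        simp only [VacPartition.list, P]
        rw [Nat.Partition.indiscrete_parts (by omega), Multiset.sort_singleton]
      rw [Finset.sum_eq_single P]
      · rw [if_pos hP]
      · intro I _ hI
        rw [if_neg]
        exact fun h => hI (VacPartition.eq_of_perm (by rw [h, hP]))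
      · simp
    · obtain rfl : n = 1 := by omega
      rw [Finset.sum_eq_zero]
      · norm_num
      · intro I _
        rw [if_neg]
        intro h
        have := I.two_le (k := 1) (by rw [h]; simp)
        omega
  rw [hval] at hlim
  refine hlim.congr' ?_
  have hdet : ∀ᶠ e in 𝓝[≠] (0 : ℂ), (scaledGram e n).det ≠ 0 :=
    nhdsWithin_le_nhds (((continuous_scaledGram n).matrix_det.continuousAt).eventually_ne
      (det_scaledGram_zero_ne n))
  filter_upwards [hdet, self_mem_nhdsWithin] with e he he0
  rw [blockVal, Finset.sum_div]
  refine Finset.sum_congr rfl fun I _ => ?_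
  rw [Finset.sum_div]
  refine Finset.sum_congr rfl fun J _ => ?_
  rw [inv_virGram_eq he0]
  have hI := I.length_pos hn
  have hJ := J.length_pos hn
  have : e ^ I.list.length * e ^ J.list.length =
      e ^ (I.list.length + J.list.length - 2) * e ^ 2 := by
    rw [← pow_add, ← pow_add]; congr 1; omega
  have he2 : e ^ 2 ≠ 0 := pow_ne_zero _ he0
  rw [eq_div_iff he2]
  linear_combination (-(casimirRho l I.list : ℂ) * (scaledGram e n)⁻¹ I J *
    (casimirRho l J.list : ℂ)) * this

theorem det_virGram_eventually_ne (N : ℕ) :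
    ∀ᶠ e in 𝓝[≠] (0 : ℂ), ∀ n ≤ N, (virGram (e ^ 2)⁻¹ n).det ≠ 0 := by
  have : ∀ᶠ e in 𝓝[≠] (0 : ℂ), ∀ n ∈ Finset.range (N + 1), (virGram (e ^ 2)⁻¹ n).det ≠ 0 := by
    rw [Filter.eventually_all_finset]
    intro n _
    have hdet : ∀ᶠ e in 𝓝[≠] (0 : ℂ), (scaledGram e n).det ≠ 0 :=
      nhdsWithin_le_nhds (((continuous_scaledGram n).matrix_det.continuousAt).eventually_ne
        (det_scaledGram_zero_ne n))
    filter_upwards [hdet, self_mem_nhdsWithin] with e he he0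
    exact det_virGram_ne_of_scaled he0 he
  filter_upwards [this] with e he n hn
  exact he n (Finset.mem_range.2 (by omega))

end FreeField

/-! ### Nonvanishing of the leading coefficient at large central charge -/

section Nonvanishing

open Polynomial

/-- The leading coefficient of `vCoeff l (m + 1)` at large central charge does not vanish. -/
theorem sum_quadratic_functional_ne_zero (m : ℕ) :
    ∑ x ∈ Finset.HasAntidiagonal.antidiagonal (2 * (m + 1)),
      ((1 - C (1 / 2 : ℝ) * X) * (1 - X) ^ m).coeff x.1 *
        (2 / ((x.2 : ℝ) + 1) - 1 / x.2) ≠ 0 := by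
  set q : ℝ[X] := (1 - C (1 / 2 : ℝ) * X) * (1 - X) ^ m with hq
  have hdeg : q.natDegree ≤ m + 1 := by
    rw [hq]; compute_degree
    omega
  have hq0 : ∀ i, m + 1 < i → q.coeff i = 0 := fun i hi =>
    coeff_eq_zero_of_natDegree_lt (lt_of_le_of_lt hdeg hi)
  -- Each 2/(n+1) - 1/n is the integral of 2s^n - s^(n-1) over [0,1]. The meaningless case n = 0 is
  -- multiplied by a coefficient of q beyond its degree.
  have hint : ∫ s in (0 : ℝ)..1, ∑ x ∈ Finset.HasAntidiagonal.antidiagonal (2 * (m + 1)),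
      q.coeff x.1 * (2 * s ^ x.2 - s ^ (x.2 - 1)) = ∑ x ∈ Finset.HasAntidiagonal.antidiagonal (2 * (m + 1)),
      q.coeff x.1 * (2 / ((x.2 : ℝ) + 1) - 1 / x.2) := by
    rw [intervalIntegral.integral_finsetSum]
    · refine Finset.sum_congr rfl fun x hx => ?_
      rw [intervalIntegral.integral_const_mul, intervalIntegral.integral_sub,
        intervalIntegral.integral_const_mul, integral_pow, integral_pow]
      · rcases Nat.eq_zero_or_pos x.2 with h | h
        · have := Finset.HasAntidiagonal.mem_antidiagonal.1 hx
          rw [hq0 x.1 (by omega)]; simp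
        · obtain ⟨j, hj⟩ : ∃ j, x.2 = j + 1 := ⟨x.2 - 1, by omega⟩
          rw [hj]
          simp
          left
          ring
      all_goals exact Continuous.intervalIntegrable (by fun_prop) _ _
    · intro x _
      exact Continuous.intervalIntegrable (by fun_prop) _ _
  -- The sum equals s^(2m+2) (2 - 1/s) q(1/s), and q contains the factor 1 - 1/(2s), half of 2 -
  -- 1/s. The resulting square gives the integrand a constant sign.
  have hpt : ∀ s : ℝ, 0 < s → ∑ x ∈ Finset.HasAntidiagonal.antidiagonal (2 * (m + 1)),
      q.coeff x.1 * (2 * s ^ x.2 - s ^ (x.2 - 1)) =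
      (-1) ^ m / 2 * ((2 * s - 1) ^ 2 * (s * (1 - s)) ^ m) := by
    intro s hs
    have hs0 : s ≠ 0 := hs.ne'
    have h1 : ∀ x ∈ Finset.HasAntidiagonal.antidiagonal (2 * (m + 1)),
        q.coeff x.1 * (2 * s ^ x.2 - s ^ (x.2 - 1)) =
        q.coeff x.1 * s⁻¹ ^ x.1 * ((2 - s⁻¹) * s ^ (2 * (m + 1))) := by
      intro x hx
      have hx' := Finset.HasAntidiagonal.mem_antidiagonal.1 hx
      rcases Nat.eq_zero_or_pos x.2 with h | h
      · rw [hq0 x.1 (by omega)]; simp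
      · have e1 : s ^ (x.2 - 1) = s ^ x.2 * s⁻¹ := by
          rw [pow_sub₀ s hs0 h, pow_one]
        rw [e1, ← hx', pow_add, inv_pow]
        field_simp
    rw [Finset.sum_congr rfl h1, ← Finset.sum_mul,
      Finset.Nat.sum_antidiagonal_eq_sum_range_succ (fun i _ => q.coeff i * s⁻¹ ^ i),
      ← eval_eq_sum_range' (show q.natDegree < (2 * (m + 1)).succ by omega)]
    simp only [hq, eval_mul, eval_sub, eval_one, eval_C, eval_X, eval_pow]
    have e2 : (1 - s⁻¹) ^ m * s ^ m = (-1) ^ m * (1 - s) ^ m := by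
      rw [← mul_pow, ← mul_pow]; congr 1; field_simp; ring
    have e3 : s ^ (2 * (m + 1)) = s ^ m * s ^ m * s ^ 2 := by ring
    rw [e3, mul_pow s]
    calc _ = (1 - 1 / 2 * s⁻¹) * (2 - s⁻¹) * s ^ 2 * s ^ m * ((1 - s⁻¹) ^ m * s ^ m) := by ring
      _ = _ := by rw [e2]; field_simp
  rw [← hint]
  have hcongr : ∫ s in (0 : ℝ)..1, ∑ x ∈ Finset.HasAntidiagonal.antidiagonal (2 * (m + 1)),
      q.coeff x.1 * (2 * s ^ x.2 - s ^ (x.2 - 1)) =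
      ∫ s in (0 : ℝ)..1, (-1) ^ m / 2 * ((2 * s - 1) ^ 2 * (s * (1 - s)) ^ m) := by
    apply intervalIntegral.integral_congr_ae
    refine Filter.Eventually.of_forall fun s hs => ?_
    rw [Set.uIoc_of_le zero_le_one] at hs
    exact hpt s hs.1
  rw [hcongr, intervalIntegral.integral_const_mul]
  refine mul_ne_zero (div_ne_zero (pow_ne_zero _ (by norm_num)) (by norm_num)) (ne_of_gt ?_)
  refine intervalIntegral.integral_pos zero_lt_one (by fun_prop) ?_ ⟨1 / 4, by norm_num, by norm_num⟩
  intro s hs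
  exact mul_nonneg (sq_nonneg _) (pow_nonneg (mul_nonneg hs.1.le (by linarith [hs.2])) _)

open Filter Topology in
-- If the rational function were zero, its values near e = 0 would vanish, against the nonzero limit
-- of c times these values. The order-zero block V_0 does not contribute, since it meets a
-- coefficient of q beyond its degree.
theorem vCoeff_succ_ne_zero {l : ℕ} (hl : 1 ≤ l) (m : ℕ) : vCoeff l (m + 1) ≠ 0 := by
  intro hzero
  set q : ℝ[X] := (1 - C (1 / 2 : ℝ) * X) * (1 - X) ^ m with hq
  have hdeg : q.natDegree ≤ m + 1 := by
    rw [hq]; compute_degree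
    omega
  have hqc : ((1 - PowerSeries.C (1 / 2 : ℂ) * PowerSeries.X) *
      (1 - PowerSeries.X) ^ m : PowerSeries ℂ) =
      PowerSeries.map Complex.ofRealHom (q : PowerSeries ℝ) := by
    rw [hq]; simp
  have hlim : Tendsto (fun e : ℂ => vVal (e ^ 2)⁻¹ l (m + 1) / e ^ 2) (𝓝[≠] 0)
      (𝓝 (∑ x ∈ Finset.HasAntidiagonal.antidiagonal (2 * (m + 1)),
        (q.coeff x.1 : ℂ) * (12 * l ^ 2 * (2 / (x.2 + 1) - 1 / x.2)))) := by
    have : (fun e : ℂ => vVal (e ^ 2)⁻¹ l (m + 1) / e ^ 2) = fun e : ℂ =>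
        ∑ x ∈ Finset.HasAntidiagonal.antidiagonal (2 * (m + 1)),
          (q.coeff x.1 : ℂ) * (blockVal (e ^ 2)⁻¹ l x.2 / e ^ 2) := by
      ext e
      rw [vVal, Nat.add_sub_cancel, hqc, PowerSeries.coeff_mul, Finset.sum_div]
      refine Finset.sum_congr rfl fun x _ => ?_
      simp
      ring
    rw [this]
    refine tendsto_finsetSum _ fun x hx => ?_
    have hx' := Finset.HasAntidiagonal.mem_antidiagonal.1 hx
    rcases Nat.eq_zero_or_pos x.2 with h | h
    · rw [coeff_eq_zero_of_natDegree_lt (show q.natDegree < x.1 by omega)]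
      simp
    · exact tendsto_const_nhds.mul (tendsto_blockVal l h)
  have hz : Tendsto (fun e : ℂ => vVal (e ^ 2)⁻¹ l (m + 1) / e ^ 2) (𝓝[≠] 0) (𝓝 0) := by
    refine tendsto_const_nhds.congr' ?_
    filter_upwards [det_virGram_eventually_ne (2 * (m + 1))] with e he
    have h1 := hasVal_vCoeff (l := l) he
    rw [hzero] at h1
    rw [h1.unique (HasVal.zero _), zero_div]
  have heq := tendsto_nhds_unique hlim hz
  have hfac : (∑ x ∈ Finset.HasAntidiagonal.antidiagonal (2 * (m + 1)),
        (q.coeff x.1 : ℂ) * (12 * l ^ 2 * (2 / (x.2 + 1) - 1 / x.2))) =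
      12 * l ^ 2 * ((∑ x ∈ Finset.HasAntidiagonal.antidiagonal (2 * (m + 1)),
        q.coeff x.1 * (2 / ((x.2 : ℝ) + 1) - 1 / x.2) : ℝ) : ℂ) := by
    push_cast
    rw [Finset.mul_sum]
    exact Finset.sum_congr rfl fun x _ => by ring
  rw [hfac] at heq
  have hl0 : (l : ℂ) ≠ 0 := by exact_mod_cast (by omega : l ≠ 0)
  have := (mul_eq_zero.1 heq).resolve_left (mul_ne_zero (by norm_num) (pow_ne_zero _ hl0))
  exact sum_quadratic_functional_ne_zero m (by exact_mod_cast this)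

end Nonvanishing

/-! ### Modes of a vertex operator algebra -/

namespace VOA

section Modes

variable {V : Type*} [AddCommGroup V] [Module ℂ V] (A : VOA V)

/-- The mode `u(n)` as a linear function of `u`. -/
def modeHom (n : ℤ) : V →ₗ[ℂ] Module.End ℂ V :=
  LinearMap.proj n ∘ₗ VertexOperator.ncoeff ∘ₗ A.Y

theorem mode_add (u v : V) (n : ℤ) : A.mode (u + v) n = A.mode u n + A.mode v n :=
  map_add (A.modeHom n) u v

theorem mode_smul (r : ℂ) (u : V) (n : ℤ) : A.mode (r • u) n = r • A.mode u n :=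
  map_smul (A.modeHom n) r u

theorem mode_zsmul_apply (z : ℤ) (u : V) (n : ℤ) (w : V) :
    A.mode (z • u) n w = z • A.mode u n w := by
  rw [← Int.cast_smul_eq_zsmul ℂ, mode_smul, LinearMap.smul_apply, Int.cast_smul_eq_zsmul]

theorem mode_zero (n : ℤ) : A.mode 0 n = 0 := map_zero (A.modeHom n)

theorem exists_mode_eq_zero (u v : V) : ∃ N : ℕ, ∀ n : ℤ, (N : ℤ) ≤ n → A.mode u n v = 0 := by
  set o := HahnSeries.order ((HahnModule.of ℂ).symm (A.Y u v))
  refine ⟨(-o).toNat, fun n hn => ?_⟩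
  refine VertexOperator.ncoeff_eq_zero_of_lt_order (A.Y u) n v ?_
  have := Int.self_le_toNat (-o)
  change _ < o
  omega

theorem L_def (n : ℤ) : A.L n = A.mode A.omega (n + 1) := rfl

theorem mode_omega (n : ℤ) : A.mode A.omega n = A.L (n - 1) := by
  rw [L_def, sub_add_cancel]

theorem mode_vac (n : ℤ) (v : V) : A.mode A.vac n v = if n = -1 then v else 0 := A.vac_mode n v

theorem mode_vac_nonneg (u : V) {n : ℤ} (hn : 0 ≤ n) : A.mode u n A.vac = 0 :=
  A.create_nonneg u n hn

theorem mode_neg_one_vac (u : V) : A.mode u (-1) A.vac = u := A.create u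

theorem L_vac {n : ℤ} (hn : -1 ≤ n) : A.L n A.vac = 0 := A.mode_vac_nonneg _ (by omega)

theorem L_comm (m n : ℤ) (v : V) :
    A.L m (A.L n v) = A.L n (A.L m v) + ((m : ℂ) - n) • A.L (m + n) v +
      if m + n = 0 then (A.c / 12 * ((m : ℂ) ^ 3 - m)) • v else 0 := by
  have h := congrArg (fun f : Module.End ℂ V => f v) (A.virasoro m n)
  simp only [LinearMap.sub_apply, LinearMap.add_apply, Module.End.mul_apply,
    LinearMap.smul_apply] at h
  have h' : A.L m (A.L n v) - A.L n (A.L m v) = ((m : ℂ) - n) • A.L (m + n) v +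
      (if m + n = 0 then (A.c / 12 * ((m : ℂ) ^ 3 - m)) • (1 : Module.End ℂ V) else 0) v := h
  rw [add_assoc, ← sub_eq_iff_eq_add', h']
  split_ifs <;> simp

theorem mode_L_neg_one (u : V) (n : ℤ) : A.mode (A.L (-1) u) n = (-(n : ℂ)) • A.mode u (n - 1) :=
  A.translation u n

theorem jacobi_mode (u v w : V) (p q r : ℤ) :
    ∑ᶠ i : ℕ, Ring.choose p i • A.mode (A.mode u (r + i) v) (p + q - i) w
      = ∑ᶠ i : ℕ, ((-1 : ℂ) ^ i * (Ring.choose r i : ℤ)) •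
          (A.mode u (p + r - i) (A.mode v (q + i) w)
            - (-1 : ℂ) ^ r • A.mode v (q + r - i) (A.mode u (p + i) w)) :=
  A.jacobi u v w p q r

/-- The commutator formula. -/
theorem mode_comm (u v w : V) (p q : ℤ) :
    A.mode u p (A.mode v q w) - A.mode v q (A.mode u p w) =
      ∑ᶠ i : ℕ, Ring.choose p i • A.mode (A.mode u i v) (p + q - i) w := by
  have h := A.jacobi_mode u v w p q 0
  simp only [zero_add, add_zero] at h
  rw [h, finsum_eq_single _ 0]
  · simp
  · intro i hi
    rw [Ring.choose_zero_pos ℤ (Nat.pos_of_ne_zero hi)]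
    simp

/-- The associativity formula. -/
theorem mode_mode (u v w : V) (r q : ℤ) :
    A.mode (A.mode u r v) q w = ∑ᶠ i : ℕ, ((-1 : ℂ) ^ i * (Ring.choose r i : ℤ)) •
          (A.mode u (r - i) (A.mode v (q + i) w)
            - (-1 : ℂ) ^ r • A.mode v (q + r - i) (A.mode u i w)) := by
  have h := A.jacobi_mode u v w 0 q r
  simp only [zero_add] at h
  rw [← h, finsum_eq_single _ 0]
  · simp
  · intro i hi
    rw [Ring.choose_zero_pos ℤ (Nat.pos_of_ne_zero hi)]
    simp

/-- The commutator formula with only its terms i = 0, 1. The hypothesis is a product so as to cover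
two cases at once: v primary, or m + 1 ∈ {0, 1}, where the binomials vanish. -/
theorem L_mode_of_quasi (m q : ℤ) (v w : V)
    (hv : ∀ i : ℕ, 2 ≤ i → Ring.choose (m + 1) i • A.L (i - 1) v = 0) :
    A.L m (A.mode v q w) = A.mode v q (A.L m w) + A.mode (A.L (-1) v) (m + 1 + q) w +
      ((m : ℂ) + 1) • A.mode (A.L 0 v) (m + q) w := by
  have h := A.mode_comm A.omega v w (m + 1) q
  rw [finsum_eq_sum_of_support_subset (s := Finset.range 2)] at h
  · rw [Finset.sum_range_succ, Finset.sum_range_one] at h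
    simp only [mode_omega, Ring.choose_zero_right, Ring.choose_one_right, one_smul] at h
    rw [add_sub_cancel_right, sub_eq_iff_eq_add'] at h
    rw [h, add_assoc (A.mode v q _), ← Int.cast_smul_eq_zsmul ℂ]
    simp only [Nat.cast_zero, Nat.cast_one, zero_sub, sub_self, sub_zero, Int.cast_add,
      Int.cast_one, show m + 1 + q - 1 = m + q by ring]
  · intro i hi
    simp only [Finset.coe_range, Set.mem_Iio]
    by_contra hlt
    apply hi
    have := hv i (by omega)
    simp only [mode_omega]
    rw [← A.mode_zsmul_apply, this, mode_zero, LinearMap.zero_apply]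

theorem mem_wt {v : V} {n : ℤ} : v ∈ A.wt n ↔ A.L 0 v = (n : ℂ) • v :=
  Module.End.mem_eigenspace_iff

theorem L_zero_mode (q : ℤ) (v w : V) :
    A.L 0 (A.mode v q w) = A.mode v q (A.L 0 w) + A.mode (A.L (-1) v) (q + 1) w +
      A.mode (A.L 0 v) q w := by
  rw [A.L_mode_of_quasi 0 q v w]
  · simp [add_comm]
  · intro i hi
    have : Ring.choose ((0 : ℤ) + 1) i = 0 := by
      rw [zero_add, ← Nat.cast_one, Ring.choose_natCast, Nat.choose_eq_zero_of_lt (by omega)]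
      rfl
    rw [this, zero_smul]

theorem L_neg_one_mode (q : ℤ) (v w : V) :
    A.L (-1) (A.mode v q w) = A.mode v q (A.L (-1) w) + (-(q : ℂ)) • A.mode v (q - 1) w := by
  rw [A.L_mode_of_quasi (-1) q v w]
  · simp [mode_L_neg_one]
  · intro i hi
    rw [neg_add_cancel, Ring.choose_zero_pos ℤ (by omega), zero_smul]

theorem mode_mem_wt {u v : V} {h k : ℤ} (hu : u ∈ A.wt h) (hv : v ∈ A.wt k) (n : ℤ) :
    A.mode u n v ∈ A.wt (h + k - n - 1) := by
  rw [mem_wt] at hu hv ⊢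
  rw [L_zero_mode, hu, hv, mode_L_neg_one, mode_smul, map_smul, LinearMap.smul_apply,
    LinearMap.smul_apply, add_sub_cancel_right, ← add_smul, ← add_smul]
  congr 1
  push_cast
  ring

theorem mode_mem_wt' {u v : V} {h k m n : ℤ} (hu : u ∈ A.wt h) (hv : v ∈ A.wt k)
    (hm : m = h + k - n - 1) : A.mode u n v ∈ A.wt m :=
  hm ▸ A.mode_mem_wt hu hv n

theorem vac_mem_wt : A.vac ∈ A.wt 0 := by
  rw [mem_wt, A.L_vac (by norm_num)]
  simp

theorem L_neg_two_vac : A.L (-2) A.vac = A.omega := A.mode_neg_one_vac A.omega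

theorem omega_mem_wt : A.omega ∈ A.wt 2 := by
  rw [mem_wt, ← L_neg_two_vac, L_comm, A.L_vac (n := 0) (by norm_num)]
  norm_num

theorem L_one_omega : A.L 1 A.omega = 0 := by
  rw [← L_neg_two_vac, L_comm, A.L_vac (n := 1) (by norm_num),
    A.L_vac (n := 1 + -2) (by norm_num)]
  norm_num

theorem L_mem_wt {v : V} {k : ℤ} (hv : v ∈ A.wt k) (n : ℤ) : A.L n v ∈ A.wt (k - n) :=
  A.mode_mem_wt' A.omega_mem_wt hv (by ring)

theorem mem_primary {l : ℕ} {a : V} :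
    a ∈ A.primary l ↔ a ∈ A.wt l ∧ ∀ m : ℤ, 0 < m → A.L m a = 0 := by
  simp [primary, Submodule.mem_iInf]

/-- The commutator of a Virasoro mode with a mode of a primary vector. -/
theorem L_mode_primary {l : ℕ} {a : V} (ha : a ∈ A.primary l) (m q : ℤ) (w : V) :
    A.L m (A.mode a q w) = A.mode a q (A.L m w) +
      (((m : ℂ) + 1) * l - (m + q + 1)) • A.mode a (m + q) w := by
  rw [mem_primary, mem_wt] at ha
  rw [A.L_mode_of_quasi m q a w, ha.1, mode_L_neg_one, mode_smul, add_assoc,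
    LinearMap.smul_apply, LinearMap.smul_apply, smul_smul, show m + 1 + q - 1 = m + q by ring,
    ← add_smul]
  · congr 2
    push_cast
    ring
  · intro i hi
    rw [ha.2 _ (by omega), smul_zero]

end Modes

/-! ### The invariant bilinear form -/

section Form

variable {V : Type*} [AddCommGroup V] [Module ℂ V] {A : VOA V} {B : LinearMap.BilinForm ℂ V}

namespace IsInvariantForm

theorem quasi (hB : A.IsInvariantForm B) {h : ℤ} {w : V} (hw : w ∈ A.wt h) (hw1 : A.L 1 w = 0)
    (n : ℤ) (u v : V) :
    B (A.mode w (2 * h - n - 2) u) v = (-1) ^ h * B u (A.mode w n v) := by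
  have key := hB.2.2 h w hw u v n
  rw [finsum_eq_single _ 0] at key
  · simp only [pow_zero, Module.End.one_apply, Nat.factorial_zero, Nat.cast_one, inv_one, mul_one,
      Nat.cast_zero, sub_zero, map_smul, LinearMap.smul_apply, smul_eq_mul] at key
    rw [← key, ← mul_assoc, ← mul_zpow]
    simp
  · intro i hi
    obtain ⟨j, rfl⟩ := Nat.exists_eq_succ_of_ne_zero hi
    rw [pow_succ, Module.End.mul_apply, hw1, map_zero, mode_zero, LinearMap.zero_apply, smul_zero]

theorem L_adjoint (hB : A.IsInvariantForm B) (n : ℤ) (u v : V) :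
    B (A.L (-n) u) v = B u (A.L n v) := by
  have := hB.quasi A.omega_mem_wt A.L_one_omega (n + 1) u v
  rw [L_def, L_def, show -n + 1 = 2 * 2 - (n + 1) - 2 by ring, this]
  norm_num

theorem primary_adjoint (hB : A.IsInvariantForm B) {l : ℕ} {a : V} (ha : a ∈ A.primary l) (n : ℤ)
    (u v : V) : B u (A.mode a n v) = (-1) ^ l * B (A.mode a (2 * l - n - 2) u) v := by
  rw [mem_primary] at ha
  rw [hB.quasi ha.1 (ha.2 1 one_pos), zpow_natCast, ← mul_assoc, ← mul_pow]
  simp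

theorem eq_zero_of_wt_ne (hB : A.IsInvariantForm B) {m n : ℤ} (hmn : m ≠ n) {u v : V}
    (hu : u ∈ A.wt m) (hv : v ∈ A.wt n) : B u v = 0 := by
  have h := hB.L_adjoint 0 u v
  rw [neg_zero, A.mem_wt.1 hu, A.mem_wt.1 hv, map_smul, map_smul, LinearMap.smul_apply,
    smul_eq_mul, smul_eq_mul] at h
  have h' : ((m : ℂ) - n) * B u v = 0 := by linear_combination h
  refine (mul_eq_zero.1 h').resolve_left ?_
  rw [sub_eq_zero]
  exact_mod_cast hmn

/-- The radical is an ideal because modes have adjoints. Invariance is given for homogeneous w only,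
hence the induction over the grading. -/
theorem mode_radical (hB : A.IsInvariantForm B) {v : V} (hv : ∀ u, B u v = 0) (w : V) (n : ℤ)
    (u : V) : B u (A.mode w n v) = 0 := by
  have hw : w ∈ ⨆ h : ℤ, A.wt h := by
    have := A.grading
    have h2 : (⨆ h : ℤ, A.wt h) = ⊤ := this
    rw [h2]; trivial
  induction hw using Submodule.iSup_induction' with
  | mem h w hw => rw [← hB.2.2 h w hw u v n]; exact hv _
  | zero => simp [mode_zero]
  | add x y _ _ hx hy => simp [mode_add, hx, hy]

/-- The invariant form of a simple vertex operator algebra is nondegenerate. -/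
theorem eq_zero_of_forall (hB : A.IsInvariantForm B) (hs : A.IsSimple) {v : V}
    (hv : ∀ u, B u v = 0) : v = 0 := by
  let I : Submodule ℂ V := LinearMap.ker B.flip
  have hI : ∀ x, x ∈ I ↔ ∀ u, B u x = 0 := fun x => by
    simp [I, LinearMap.ext_iff]
  rcases hs.2 I (fun u n x hx => (hI _).2 (hB.mode_radical ((hI x).1 hx) u n)) with h | h
  · have : v ∈ I := (hI v).2 hv
    rw [h] at this
    exact this
  · have : A.vac ∈ I := by rw [h]; trivial
    have := (hI _).1 this A.vac
    rw [hB.2.1] at this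
    exact absurd this one_ne_zero

theorem eq_zero_of_forall_wt (hB : A.IsInvariantForm B) (hs : A.IsSimple) {n : ℤ} {v : V}
    (hvn : v ∈ A.wt n) (hv : ∀ u ∈ A.wt n, B u v = 0) : v = 0 := by
  refine hB.eq_zero_of_forall hs fun u => ?_
  have hw : u ∈ ⨆ h : ℤ, A.wt h := by
    have h2 : (⨆ h : ℤ, A.wt h) = ⊤ := A.grading
    rw [h2]; trivial
  induction hw using Submodule.iSup_induction' with
  | mem h w hw =>
    rcases eq_or_ne h n with rfl | hne
    · exact hv _ hw
    · exact hB.eq_zero_of_wt_ne hne hw hvn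
  | zero => simp
  | add x y _ _ hx hy => simp [hx, hy]

end IsInvariantForm

end Form

end VOA

/-! ### The Virasoro vacuum module -/

namespace VOA

section Fock

variable {V : Type*} [AddCommGroup V] [Module ℂ V] (A : VOA V)

theorem fock_nil : A.fock [] = A.vac := rfl

theorem fock_cons (n : ℕ) (w : List ℕ) : A.fock (n :: w) = A.L (-(n : ℤ)) (A.fock w) := rfl

theorem fock_mem_wt (w : List ℕ) : A.fock w ∈ A.wt (w.sum : ℕ) := by
  induction w with
  | nil => exact A.vac_mem_wt
  | cons n w ih =>
    have := A.L_mem_wt ih (-(n : ℤ))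
    rw [fock_cons, List.sum_cons]
    convert this using 2
    push_cast
    ring

theorem fock_mem_virasoroSub {w : List ℕ} (hw : ∀ n ∈ w, 2 ≤ n) : A.fock w ∈ A.virasoroSub :=
  Submodule.subset_span ⟨w, hw, rfl⟩

theorem virasoroSub_induction {p : V → Prop} (hf : ∀ w : List ℕ, (∀ n ∈ w, 2 ≤ n) → p (A.fock w))
    (h0 : p 0) (hadd : ∀ x y, p x → p y → p (x + y)) (hsmul : ∀ (r : ℂ) x, p x → p (r • x))
    {v : V} (hv : v ∈ A.virasoroSub) : p v := by
  induction hv using Submodule.span_induction with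
  | mem x hx => obtain ⟨w, hw, rfl⟩ := hx; exact hf w hw
  | zero => exact h0
  | add x y _ _ hx hy => exact hadd x y hx hy
  | smul r x _ hx => exact hsmul r x hx

theorem L_fock_mem (w : List ℕ) : (∀ n ∈ w, 2 ≤ n) → ∀ m : ℤ, A.L m (A.fock w) ∈ A.virasoroSub := by
  induction w with
  | nil =>
    intro _ m
    rcases le_or_gt (-1) m with h | h
    · rw [fock_nil, A.L_vac h]; exact zero_mem _
    · have : A.L m (A.fock []) = A.fock [m.natAbs] := by
        rw [fock_cons]; congr 2; omega
      rw [this]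
      exact A.fock_mem_virasoroSub (by simp; omega)
  | cons n w ih =>
    intro hw m
    have hw' : ∀ k ∈ w, 2 ≤ k := fun k hk => hw k (by simp [hk])
    have hn : 2 ≤ n := hw n (by simp)
    rw [fock_cons, L_comm]
    refine add_mem (add_mem ?_ (Submodule.smul_mem _ _ (ih hw' _))) ?_
    · refine A.virasoroSub_induction (p := fun x => A.L (-(n : ℤ)) x ∈ A.virasoroSub) ?_ (by simp)
        (fun x y hx hy => by rw [map_add]; exact add_mem hx hy)
        (fun r x hx => by rw [map_smul]; exact Submodule.smul_mem _ _ hx) (ih hw' m)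
      intro s hs
      rw [← fock_cons]
      exact A.fock_mem_virasoroSub (by simpa [hn] using hs)
    · split_ifs
      · exact Submodule.smul_mem _ _ (A.fock_mem_virasoroSub hw')
      · exact zero_mem _

theorem L_mem_virasoroSub {v : V} (hv : v ∈ A.virasoroSub) (m : ℤ) : A.L m v ∈ A.virasoroSub :=
  A.virasoroSub_induction (p := fun x => A.L m x ∈ A.virasoroSub)
    (fun w hw => A.L_fock_mem w hw m) (by simp)
    (fun x y hx hy => by rw [map_add]; exact add_mem hx hy)
    (fun r x hx => by rw [map_smul]; exact Submodule.smul_mem _ _ hx) hv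

/-- The span of the descendants of weight `N` and length at most `k`. -/
def fockSpan (k N : ℕ) : Submodule ℂ V :=
  Submodule.span ℂ {v | ∃ w : List ℕ, (∀ n ∈ w, 2 ≤ n) ∧ w.length ≤ k ∧ w.sum = N ∧ A.fock w = v}

theorem fock_mem_fockSpan {w : List ℕ} (hw : ∀ n ∈ w, 2 ≤ n) {k N : ℕ} (hk : w.length ≤ k)
    (hN : w.sum = N) : A.fock w ∈ A.fockSpan k N :=
  Submodule.subset_span ⟨w, hw, hk, hN, rfl⟩

theorem L_mem_fockSpan {n k N : ℕ} (hn : 2 ≤ n) {v : V} (hv : v ∈ A.fockSpan k N) :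
    A.L (-(n : ℤ)) v ∈ A.fockSpan (k + 1) (n + N) := by
  induction hv using Submodule.span_induction with
  | mem x hx =>
    obtain ⟨w, hw, hk, hN, rfl⟩ := hx
    rw [← fock_cons]
    exact A.fock_mem_fockSpan (by simpa [hn] using hw) (by simpa using hk) (by simp [hN])
  | zero => simp
  | add x y _ _ hx hy => rw [map_add]; exact add_mem hx hy
  | smul r x _ hx => rw [map_smul]; exact Submodule.smul_mem _ _ hx

/-- The reordering step of a Poincaré–Birkhoff–Witt argument: exchanging two neighbours costs a
commutator, which is a shorter descendant. Two lowering modes produce no central term. -/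
theorem fock_sub_fock_mem_of_perm {w w' : List ℕ} (h : w.Perm w') : (∀ n ∈ w, 2 ≤ n) →
    ∀ k, w.length ≤ k + 1 → A.fock w - A.fock w' ∈ A.fockSpan k w.sum := by
  induction h with
  | nil => intro _ k _; simp
  | @cons x l₁ l₂ hp ih =>
    intro hw k hk
    cases k with
    | zero =>
      have h1 : l₁ = [] := List.length_eq_zero_iff.1 (by simpa using hk)
      subst h1
      obtain rfl := List.nil_perm.1 hp
      simp
    | succ k =>
      have := A.L_mem_fockSpan (hw x (by simp))
        (ih (fun n hn => hw n (by simp [hn])) k (by simpa using hk))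
      rwa [map_sub] at this
  | swap x y l =>
    intro hw k hk
    have hx : 2 ≤ x := hw x (by simp)
    have hy : 2 ≤ y := hw y (by simp)
    have : A.fock (y :: x :: l) - A.fock (x :: y :: l) =
        (((-(y : ℤ) : ℤ) : ℂ) - ((-(x : ℤ) : ℤ) : ℂ)) • A.fock ((y + x) :: l) := by
      simp only [fock_cons]
      rw [A.L_comm (-(y : ℤ)) (-(x : ℤ)), if_neg (by omega),
        show -(y : ℤ) + -(x : ℤ) = -((y + x : ℕ) : ℤ) by push_cast; ring]
      abel
    rw [this]
    refine Submodule.smul_mem _ _ (A.fock_mem_fockSpan ?_ (by simpa using hk) (by simp; ring))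
    intro n hn
    rcases List.mem_cons.1 hn with rfl | hn
    · omega
    · exact hw n (by simp [hn])
  | @trans l₁ l₂ l₃ h12 h23 ih1 ih2 =>
    intro hw k hk
    have h1 := ih1 hw k hk
    have h2 := ih2 (fun n hn => hw n (h12.symm.subset hn)) k (by rwa [← h12.length_eq])
    rw [← h12.sum_eq] at h2
    have := add_mem h1 h2
    rwa [sub_add_sub_cancel] at this

theorem exists_vacPartition_perm {w : List ℕ} (hw : ∀ n ∈ w, 2 ≤ n) {N : ℕ} (hN : w.sum = N) :
    ∃ P : VacPartition N, w.Perm P.list := by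
  refine ⟨⟨⟨(w : Multiset ℕ), fun {i} hi => ?_, by simpa using hN⟩, fun h => ?_⟩, ?_⟩
  · have := hw i (by simpa using hi); omega
  · have := hw 1 (by simpa using h); omega
  · rw [← Multiset.coe_eq_coe, VacPartition.coe_list]

/-- The span of the ordered Fock vectors of weight `n`. -/
def virasoroWt (n : ℕ) : Submodule ℂ V :=
  Submodule.span ℂ (Set.range fun P : VacPartition n => A.fock P.list)

theorem fockSpan_le (k N : ℕ) : A.fockSpan k N ≤ A.virasoroWt N := by
  induction k with
  | zero =>
    refine Submodule.span_le.2 ?_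
    rintro _ ⟨w, hw, hk, hN, rfl⟩
    obtain ⟨P, hP⟩ := exists_vacPartition_perm hw hN
    have h1 : w = [] := List.length_eq_zero_iff.1 (by simpa using hk)
    subst h1
    exact Submodule.subset_span ⟨P, congrArg A.fock (List.nil_perm.1 hP)⟩
  | succ k ih =>
    refine Submodule.span_le.2 ?_
    rintro _ ⟨w, hw, hk, hN, rfl⟩
    obtain ⟨P, hP⟩ := exists_vacPartition_perm hw hN
    have h := ih (hN ▸ A.fock_sub_fock_mem_of_perm hP hw k hk)
    have := add_mem h (Submodule.subset_span ⟨P, rfl⟩ : A.fock P.list ∈ A.virasoroWt N)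
    rwa [sub_add_cancel] at this

theorem virasoroWt_le_wt (n : ℕ) : A.virasoroWt n ≤ A.wt n := by
  refine Submodule.span_le.2 ?_
  rintro _ ⟨P, rfl⟩
  have := A.fock_mem_wt P.list
  rwa [P.sum_list] at this

theorem virasoroWt_le_virasoroSub (n : ℕ) : A.virasoroWt n ≤ A.virasoroSub := by
  refine Submodule.span_le.2 ?_
  rintro _ ⟨P, rfl⟩
  exact A.fock_mem_virasoroSub fun k hk => P.two_le hk

/-- This expresses that V_ω is graded. The remainder r is orthogonal to V_n, so pairing with V_n
sees only s. -/
theorem exists_component {v : V} (hv : v ∈ A.virasoroSub) (n : ℕ) :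
    ∃ s ∈ A.virasoroWt n, ∃ r ∈ ⨆ j : ℤ, ⨆ _ : j ≠ n, A.wt j, v = s + r := by
  refine A.virasoroSub_induction (p := fun v => ∃ s ∈ A.virasoroWt n,
    ∃ r ∈ ⨆ j : ℤ, ⨆ _ : j ≠ n, A.wt j, v = s + r) ?_ ⟨0, zero_mem _, 0, zero_mem _, by simp⟩
    ?_ ?_ hv
  · intro w hw
    by_cases h : w.sum = n
    · exact ⟨A.fock w, A.fockSpan_le _ _ (A.fock_mem_fockSpan hw le_rfl h), 0, zero_mem _, by simp⟩
    · refine ⟨0, zero_mem _, A.fock w, ?_, by simp⟩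
      exact Submodule.mem_iSup_of_mem (w.sum : ℤ) (Submodule.mem_iSup_of_mem
        (by exact_mod_cast h) (A.fock_mem_wt w))
  · rintro x y ⟨s, hs, r, hr, rfl⟩ ⟨s', hs', r', hr', rfl⟩
    exact ⟨s + s', add_mem hs hs', r + r', add_mem hr hr', by abel⟩
  · rintro t x ⟨s, hs, r, hr, rfl⟩
    exact ⟨t • s, Submodule.smul_mem _ _ hs, t • r, Submodule.smul_mem _ _ hr, by simp⟩

/-- The product of Virasoro modes applied to a vector. -/
def applyModes (w : List ℤ) (x : V) : V := w.foldr (fun n v => A.L n v) x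

theorem fock_eq_applyModes (w : List ℕ) :
    A.fock w = A.applyModes (w.map fun k : ℕ => -(k : ℤ)) A.vac := by
  induction w with
  | nil => rfl
  | cons n w ih => rw [fock_cons, ih]; rfl

/-- Commuting L(n) to the right until it kills the vacuum gives exactly the recursion that defines
`virVev`. -/
theorem L_applyModes_vac {n : ℤ} (hn : -1 ≤ n) (w : List ℤ) :
    A.L n (A.applyModes w A.vac) = ∑ i : Fin w.length,
      (((n : ℂ) - (w.get i : ℂ)) • A.applyModes (w.set i (n + w.get i)) A.vac +
        if n + w.get i = 0 then (A.c / 12 * ((n : ℂ) ^ 3 - n)) • A.applyModes (w.eraseIdx i) A.vac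
        else 0) := by
  induction w with
  | nil => exact A.L_vac hn
  | cons m w ih =>
    have hc : ∀ (k : ℤ) (w : List ℤ), A.applyModes (k :: w) A.vac =
      A.L k (A.applyModes w A.vac) := fun _ _ => rfl
    rw [hc, L_comm, ih]
    simp only [List.length_cons]
    rw [Fin.sum_univ_succ, map_sum, add_assoc, add_comm]
    congr 1
    refine Finset.sum_congr rfl fun i _ => ?_
    rw [map_add, map_smul, apply_ite (A.L m), map_smul, map_zero]
    rfl

end Fock

/-! ### The Gram matrix and projection to the Virasoro vacuum module -/

section Gram

variable {V : Type*} [AddCommGroup V] [Module ℂ V] {A : VOA V} {B : LinearMap.BilinForm ℂ V}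

namespace IsInvariantForm

theorem vev_eq (hB : A.IsInvariantForm B) (w : List ℤ) :
    B A.vac (A.applyModes w A.vac) = virVev A.c w := by
  induction w using virVev.induct with
  | case1 => rw [virVev]; exact hB.2.1
  | case2 n w h =>
    rw [virVev, if_pos h]
    change B A.vac (A.L n (A.applyModes w A.vac)) = 0
    rw [← hB.L_adjoint, A.L_vac (by omega)]
    simp
  | case3 n w h ih1 ih2 =>
    rw [virVev, if_neg h]
    change B A.vac (A.L n (A.applyModes w A.vac)) = _
    rw [A.L_applyModes_vac (by omega), map_sum]
    refine Finset.sum_congr rfl fun i _ => ?_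
    rw [map_add, map_smul, ih1, apply_ite (B A.vac), map_smul, ih2, map_zero, smul_eq_mul,
      smul_eq_mul]

theorem fock_left (hB : A.IsInvariantForm B) (I : List ℕ) : ∀ x : V,
    B (A.fock I) x = B A.vac (A.applyModes (I.reverse.map (Nat.cast : ℕ → ℤ)) x) := by
  induction I with
  | nil => intro x; rfl
  | cons i I ih =>
    intro x
    rw [fock_cons, hB.L_adjoint, ih, List.reverse_cons, List.map_append]
    simp [applyModes]

theorem gram_eq (hB : A.IsInvariantForm B) (n : ℕ) (I J : VacPartition n) :
    B (A.fock I.list) (A.fock J.list) = virGram A.c n I J := by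
  rw [hB.fock_left, virGram_apply, ← hB.vev_eq, modeList, A.fock_eq_applyModes]
  simp only [applyModes, List.foldr_append]

/-- The pairing of a Virasoro descendant of the vacuum with a family of vectors on which the
Virasoro modes act as on the Casimir vectors. -/
theorem fock_pairing (hB : A.IsInvariantForm B) (l : ℕ) (T : ℤ → V)
    (hT : ∀ m : ℕ, 2 ≤ m → ∀ n : ℤ,
      A.L m (T n) = ((n : ℂ) - m + l * (m - 1)) • T (n - m)) (w : List ℕ) :
    (∀ n ∈ w, 2 ≤ n) → B (A.fock w) (T (w.sum : ℕ)) = casimirRho l w * B A.vac (T 0) := by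
  induction w with
  | nil => intro _; simp [casimirRho, fock_nil]
  | cons i w ih =>
    intro hw
    rw [fock_cons, hB.L_adjoint, hT i (hw i (by simp)), map_smul, List.sum_cons,
      show ((i + w.sum : ℕ) : ℤ) - i = (w.sum : ℕ) by push_cast; ring,
      ih fun n hn => hw n (by simp [hn]), casimirRho]
    push_cast
    simp only [smul_eq_mul]
    ring

theorem orthogonal_iSup_wt (hB : A.IsInvariantForm B) {n : ℤ} {v : V} (hv : v ∈ A.wt n) {r : V}
    (hr : r ∈ ⨆ j : ℤ, ⨆ _ : j ≠ n, A.wt j) : B r v = 0 := by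
  have : (⨆ j : ℤ, ⨆ _ : j ≠ n, A.wt j) ≤ LinearMap.ker (B.flip v) := by
    refine iSup_le fun j => iSup_le fun hj x hx => ?_
    exact hB.eq_zero_of_wt_ne hj hx hv
  exact this hr

theorem orthogonal_virasoroSub (hB : A.IsInvariantForm B) {n : ℕ} {v : V} (hv : v ∈ A.wt n)
    (h : ∀ P : VacPartition n, B (A.fock P.list) v = 0) {x : V} (hx : x ∈ A.virasoroSub) :
    B x v = 0 := by
  obtain ⟨s, hs, r, hr, rfl⟩ := A.exists_component hx n
  rw [map_add, LinearMap.add_apply, hB.orthogonal_iSup_wt hv hr, add_zero]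
  have : A.virasoroWt n ≤ LinearMap.ker (B.flip v) := by
    refine Submodule.span_le.2 ?_
    rintro _ ⟨P, rfl⟩
    exact h P
  exact this hs

/-- The form is nondegenerate on the part of the Virasoro vacuum module without singular
vectors. -/
theorem eq_zero_of_orthogonal (hB : A.IsInvariantForm B) (hC : A.IsStrongCFT) {N : ℕ}
    (hN : A.NoSingularUpTo N) (n : ℕ) : n ≤ N → ∀ v ∈ A.virasoroSub, v ∈ A.wt n →
    (∀ x ∈ A.virasoroSub, B x v = 0) → v = 0 := by
  induction n using Nat.strong_induction_on with
  | _ n ih =>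
    intro hn v hv hvn ho
    rcases Nat.eq_zero_or_pos n with rfl | hpos
    · rw [Nat.cast_zero, hC.2.1] at hvn
      obtain ⟨t, rfl⟩ := Submodule.mem_span_singleton.1 hvn
      have := ho A.vac (A.fock_mem_virasoroSub (w := []) (by simp))
      rw [map_smul, hB.2.1, smul_eq_mul, mul_one] at this
      rw [this, zero_smul]
    -- L(m)v is again orthogonal to V_ω and has smaller weight, so it vanishes by induction. Then v
    -- is singular, hence zero.
    · refine (hN n hn).2 hpos v ⟨hv, hvn⟩ fun m hm => ?_
      have hw := A.L_mem_wt hvn m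
      rcases le_or_gt m n with hmn | hmn
      · refine ih (n - m.toNat) (by omega) (by omega) _ (A.L_mem_virasoroSub hv m) ?_ fun x hx => ?_
        · convert hw using 2; omega
        · rw [← hB.L_adjoint]
          exact ho _ (A.L_mem_virasoroSub hx _)
      · rw [hC.1 _ (by omega)] at hw
        exact hw

/-- A kernel vector of the Gram matrix is a combination of Fock vectors orthogonal to V_ω. It is
zero by `eq_zero_of_orthogonal`, against linear independence. -/
theorem det_virGram_ne (hB : A.IsInvariantForm B) (hC : A.IsStrongCFT) {N : ℕ}
    (hN : A.NoSingularUpTo N) {n : ℕ} (hn : n ≤ N) : (virGram A.c n).det ≠ 0 := by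
  intro h0
  obtain ⟨x, hx0, hx⟩ := Matrix.exists_mulVec_eq_zero_iff.2 h0
  set v := ∑ J : VacPartition n, x J • A.fock J.list with hv
  have hvW : v ∈ A.virasoroWt n :=
    Submodule.sum_mem _ fun J _ => Submodule.smul_mem _ _ (Submodule.subset_span ⟨J, rfl⟩)
  have horth : ∀ P : VacPartition n, B (A.fock P.list) v = 0 := by
    intro P
    have := congrFun hx P
    rw [Matrix.mulVec, dotProduct] at this
    rw [hv, map_sum, ← (show _ = (0 : ℂ) from this)]
    refine Finset.sum_congr rfl fun J _ => ?_
    rw [map_smul, hB.gram_eq, smul_eq_mul, mul_comm]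
  have hz := hB.eq_zero_of_orthogonal hC hN n hn v (A.virasoroWt_le_virasoroSub n hvW)
    (A.virasoroWt_le_wt n hvW)
    fun y hy => hB.orthogonal_virasoroSub (A.virasoroWt_le_wt n hvW) horth hy
  exact hx0 (funext fun J => (Fintype.linearIndependent_iff.1 (hN n hn).1) x hz J)

/-- The orthogonal projection to the Virasoro vacuum module in weight `n`. -/
theorem sum_fock_inv (hB : A.IsInvariantForm B) {n : ℕ} (h : (virGram A.c n).det ≠ 0)
    (X : VacPartition n → ℂ) (I : VacPartition n) :
    B (A.fock I.list) (∑ J : VacPartition n, (((virGram A.c n)⁻¹).mulVec X) J • A.fock J.list) =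
      X I := by
  rw [map_sum]
  have h1 : (virGram A.c n).mulVec (((virGram A.c n)⁻¹).mulVec X) = X := by
    rw [Matrix.mulVec_mulVec, Matrix.mul_nonsing_inv _ (isUnit_iff_ne_zero.2 h), Matrix.one_mulVec]
  conv_rhs => rw [← h1]
  rw [Matrix.mulVec, dotProduct]
  refine Finset.sum_congr rfl fun J _ => ?_
  rw [map_smul, hB.gram_eq, smul_eq_mul, mul_comm]

theorem eq_sum_fock (hB : A.IsInvariantForm B) (hC : A.IsStrongCFT) {N : ℕ}
    (hN : A.NoSingularUpTo N) {n : ℕ} (hn : n ≤ N) {x : V} (hx : x ∈ A.virasoroSub)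
    (hxn : x ∈ A.wt n) :
    x = ∑ J : VacPartition n, (((virGram A.c n)⁻¹).mulVec fun I => B (A.fock I.list) x) J •
      A.fock J.list := by
  have hdet := hB.det_virGram_ne hC hN hn
  rw [← sub_eq_zero]
  set y := ∑ J : VacPartition n, (((virGram A.c n)⁻¹).mulVec fun I => B (A.fock I.list) x) J •
      A.fock J.list with hy
  have hyW : y ∈ A.virasoroWt n :=
    Submodule.sum_mem _ fun J _ => Submodule.smul_mem _ _ (Submodule.subset_span ⟨J, rfl⟩)
  have hwt : x - y ∈ A.wt n := sub_mem hxn (A.virasoroWt_le_wt n hyW)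
  refine hB.eq_zero_of_orthogonal hC hN n hn _ (sub_mem hx (A.virasoroWt_le_virasoroSub n hyW))
    hwt fun z hz => hB.orthogonal_virasoroSub hwt (fun P => ?_) hz
  rw [map_sub, hy, hB.sum_fock_inv hdet, sub_self]

/-- Expanding x in Fock vectors puts the inverse Gram matrix between the pairings with x and the
values of f. Both are proportional to ρ_l, which leaves the block coefficient. -/
theorem eq_blockVal (hB : A.IsInvariantForm B) (hC : A.IsStrongCFT) {N : ℕ}
    (hN : A.NoSingularUpTo N) {n : ℕ} (hn : n ≤ N) {x : V} (hx : x ∈ A.virasoroSub)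
    (hxn : x ∈ A.wt n) (f : V →ₗ[ℂ] ℂ) (l : ℕ) (α β : ℂ)
    (hα : ∀ P : VacPartition n, B (A.fock P.list) x = casimirRho l P.list * α)
    (hβ : ∀ P : VacPartition n, f (A.fock P.list) = casimirRho l P.list * β) :
    f x = α * β * blockVal A.c l n := by
  rw [hB.eq_sum_fock hC hN hn hx hxn, map_sum, blockVal, Finset.mul_sum]
  refine Finset.sum_congr rfl fun J _ => ?_
  rw [map_smul, hβ, Matrix.mulVec, dotProduct, smul_eq_mul, Finset.sum_mul, Finset.mul_sum]
  refine Finset.sum_congr rfl fun I _ => ?_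
  rw [hα]
  ring

/-- If all vectors of weight less than `k` are Virasoro descendants of the vacuum, a vector of
weight `k` is the sum of a descendant and a primary vector. -/
theorem exists_add_primary (hB : A.IsInvariantForm B) (hC : A.IsStrongCFT) {N : ℕ}
    (hN : A.NoSingularUpTo N) {k : ℕ} (hk : k ≤ N)
    (hlow : ∀ j : ℕ, j < k → A.wt j ≤ A.virasoroSub) {v : V} (hv : v ∈ A.wt k) :
    ∃ s ∈ A.virasoroSub, ∃ p ∈ A.primary k, v = s + p := by
  have hdet := hB.det_virGram_ne hC hN hk
  set y := ∑ J : VacPartition k, (((virGram A.c k)⁻¹).mulVec fun I => B (A.fock I.list) v) J •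
      A.fock J.list with hy
  have hyW : y ∈ A.virasoroWt k :=
    Submodule.sum_mem _ fun J _ => Submodule.smul_mem _ _ (Submodule.subset_span ⟨J, rfl⟩)
  have hwt : v - y ∈ A.wt k := sub_mem hv (A.virasoroWt_le_wt k hyW)
  have horth : ∀ x ∈ A.virasoroSub, B x (v - y) = 0 := fun x hx =>
    hB.orthogonal_virasoroSub hwt (fun P => by
      rw [map_sub, hy, hB.sum_fock_inv hdet, sub_self]) hx
  refine ⟨y, A.virasoroWt_le_virasoroSub k hyW, v - y, ?_, by abel⟩
  refine A.mem_primary.2 ⟨hwt, fun m hm => ?_⟩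
  have hw := A.L_mem_wt hwt m
  rcases le_or_gt m k with hmk | hmk
  · have hw' : A.L m (v - y) ∈ A.wt (k - m.toNat : ℕ) := by convert hw using 2; omega
    refine hB.eq_zero_of_orthogonal hC hN (k - m.toNat) (by omega) _ (hlow _ (by omega) hw') hw'
      fun x hx => ?_
    rw [← hB.L_adjoint]
    exact horth _ (A.L_mem_virasoroSub hx _)
  · rw [hC.1 _ (by omega)] at hw
    exact hw

theorem wt_le_virasoroSub (hB : A.IsInvariantForm B) (hC : A.IsStrongCFT) {N l : ℕ}
    (hN : A.NoSingularUpTo N) (hlN : l ≤ N) (hlow : ∀ k : ℕ, 1 ≤ k → k < l → A.primary k = ⊥)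
    (k : ℕ) : k < l → A.wt k ≤ A.virasoroSub := by
  induction k using Nat.strong_induction_on with
  | _ k ih =>
    intro hk v hv
    rcases Nat.eq_zero_or_pos k with rfl | hpos
    · rw [Nat.cast_zero, hC.2.1] at hv
      obtain ⟨t, rfl⟩ := Submodule.mem_span_singleton.1 hv
      exact Submodule.smul_mem _ _ (A.fock_mem_virasoroSub (w := []) (by simp))
    · obtain ⟨s, hs, p, hp, rfl⟩ := hB.exists_add_primary hC hN (by omega)
        (fun j hj => ih j hj (by omega)) hv
      rw [hlow k hpos hk] at hp
      rw [(Submodule.mem_bot ℂ).1 hp, add_zero]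
      exact hs

theorem primary_orthogonal (hB : A.IsInvariantForm B) {l : ℕ} (hl : 1 ≤ l) {a : V}
    (ha : a ∈ A.primary l) {x : V} (hx : x ∈ A.virasoroSub) : B x a = 0 := by
  rw [A.mem_primary] at ha
  refine A.virasoroSub_induction (p := fun x => B x a = 0) ?_ (by simp)
    (fun x y hx hy => by simp [hx, hy]) (fun r x hx => by simp [hx]) hx
  intro w hw
  cases w with
  | nil => exact hB.eq_zero_of_wt_ne (by omega) A.vac_mem_wt ha.1
  | cons n w =>
    rw [fock_cons, hB.L_adjoint, ha.2 _ (by have := hw n (by simp); omega), map_zero]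

end IsInvariantForm

end Gram

end VOA

/-! ### Pairs of primary vectors -/

namespace VOA

section Pairs

variable {V : Type*} [AddCommGroup V] [Module ℂ V] {A : VOA V} {B : LinearMap.BilinForm ℂ V}
  {l : ℕ} {a b u v : V}

theorem eq_zero_of_mem_wt_neg (hC : A.IsStrongCFT) {x : V} {n : ℤ} (hn : n < 0) (hx : x ∈ A.wt n) :
    x = 0 := by
  rw [hC.1 n hn] at hx
  exact hx

theorem L_mode_primary_primary (hu : u ∈ A.primary l) (hv : v ∈ A.primary l) {m : ℤ} (hm : 0 < m)
    (n : ℤ) : A.L m (A.mode u (2 * l - n - 1) v) =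
      ((n : ℂ) - m + l * (m - 1)) • A.mode u (2 * l - (n - m) - 1) v := by
  rw [A.L_mode_primary hu, (A.mem_primary.1 hv).2 m hm, map_zero, zero_add,
    show m + (2 * (l : ℤ) - n - 1) = 2 * l - (n - m) - 1 by ring]
  congr 1
  push_cast
  ring

theorem mode_primary_mem_wt (hu : u ∈ A.primary l) (hv : v ∈ A.primary l) (n : ℤ) :
    A.mode u (2 * l - n - 1) v ∈ A.wt n :=
  A.mode_mem_wt' (A.mem_primary.1 hu).1 (A.mem_primary.1 hv).1 (by ring)

namespace IsInvariantForm

theorem vac_mode_primary (hB : A.IsInvariantForm B) (hu : u ∈ A.primary l) (v : V) :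
    B A.vac (A.mode u (2 * l - 1) v) = (-1) ^ l * B u v := by
  rw [hB.primary_adjoint hu, show 2 * (l : ℤ) - (2 * l - 1) - 2 = -1 by ring, A.mode_neg_one_vac]

theorem fock_pairing_primary (hB : A.IsInvariantForm B) (hu : u ∈ A.primary l)
    (hv : v ∈ A.primary l) {n : ℕ} (P : VacPartition n) :
    B (A.fock P.list) (A.mode u (2 * l - n - 1) v) = casimirRho l P.list * ((-1) ^ l * B u v) := by
  have h := hB.fock_pairing l (fun n : ℤ => A.mode u (2 * l - n - 1) v) (fun m hm n => by
    have := L_mode_primary_primary (A := A) hu hv (m := m) (by omega) n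
    simpa using this) P.list (fun k hk => P.two_le hk)
  simp only [P.sum_list, sub_zero] at h
  rw [h, hB.vac_mode_primary hu]

/-- The matrix elements of the zero modes of Virasoro descendants between primary vectors. -/
theorem fock_mode_primary (hB : A.IsInvariantForm B) (ha : a ∈ A.primary l)
    (hb : b ∈ A.primary l) (w : List ℕ) : (∀ n ∈ w, 2 ≤ n) →
    B a (A.mode (A.fock w) ((w.sum : ℕ) - 1) b) = casimirRho l w * ((-1) ^ w.sum * B a b) := by
  induction w with
  | nil => intro _; simp [fock_nil, mode_vac, casimirRho]
  | cons i w ih =>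
    intro hw
    have hi : 2 ≤ i := hw i (by simp)
    rw [A.mem_primary] at ha hb
    have hz : ∀ (m : ℤ) (x : V), m < 0 → B a (A.L m x) = 0 := fun m x hm => by
      rw [hB.1, ← neg_neg m, hB.L_adjoint, ha.2 _ (by omega), map_zero]
    set q : ℤ := ((i :: w).sum : ℕ) - 1 with hq
    -- Associativity with r = 1 - i, because ω(1-i) = L(-i).
    have h := A.mode_mode A.omega (A.fock w) b (1 - i) q
    have hω : A.mode A.omega (1 - i) (A.fock w) = A.fock (i :: w) := by
      rw [mode_omega, fock_cons]; congr 2; ring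
    rw [hω] at h
    rw [finsum_eq_sum_of_support_subset (s := insert 0 (insert 1 ((Set.Finite.toFinset (s :=
      Function.support fun j : ℕ => A.mode (A.fock w) (q + j) b) (by
        obtain ⟨N, hN⟩ := A.exists_mode_eq_zero (A.fock w) b
        refine (Set.finite_Iio (N + q.natAbs)).subset fun j hj => ?_
        by_contra hlt
        exact hj (hN _ (by simp at hlt; omega)))))))] at h
    swap
    · intro j hj
      by_contra hne
      simp only [Finset.coe_insert, Set.mem_insert_iff, not_or, Set.Finite.coe_toFinset,
        Function.mem_support, not_not] at hne
      apply hj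
      simp only
      rw [hne.2.2, A.mode_omega j, hb.2 _ (by omega)]
      simp
    set s : Finset ℕ := (Set.Finite.toFinset (s :=
      Function.support fun j : ℕ => A.mode (A.fock w) (q + j) b) _) with hs
    rw [h, map_sum]
    have hterm : ∀ j : ℕ, B a (((-1 : ℂ) ^ j * (Ring.choose (1 - (i : ℤ)) j : ℤ)) •
        (A.mode A.omega (1 - i - j) (A.mode (A.fock w) (q + j) b) - (-1 : ℂ) ^ (1 - (i : ℤ)) •
          A.mode (A.fock w) (q + (1 - i) - j) (A.mode A.omega j b))) =
        ((-1 : ℂ) ^ j * (Ring.choose (1 - (i : ℤ)) j : ℤ)) * (- (-1 : ℂ) ^ (1 - (i : ℤ)) *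
          B a (A.mode (A.fock w) (q + (1 - i) - j) (A.L (j - 1) b))) := by
      intro j
      rw [map_smul, map_sub, map_smul, A.mode_omega (1 - i - j), hz _ _ (by omega), A.mode_omega j]
      simp
    simp only [hterm]
    -- The terms with a Virasoro mode on the left vanish against the primary a. Among the others b
    -- kills j ≥ 2, leaving L(-1)b and L(0)b; these give the summands Σw and l(i-1) of the new
    -- factor of ρ_l.
    rw [Finset.sum_subset_zero_on_sdiff (s₁ := {0, 1}) (f := fun j : ℕ =>
      ((-1 : ℂ) ^ j * (Ring.choose (1 - (i : ℤ)) j : ℤ)) * (- (-1 : ℂ) ^ (1 - (i : ℤ)) *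
          B a (A.mode (A.fock w) (q + (1 - i) - j) (A.L (j - 1) b)))) (s₂ := insert 0 (insert 1 s))
      (by intro x hx; simp at hx ⊢; tauto) (by
        intro j hj
        simp at hj
        rw [hb.2 _ (by omega)]
        simp) (fun _ _ => rfl) |>.symm]
    rw [Finset.sum_pair (by norm_num)]
    have e1 : B a (A.mode (A.fock w) (q + (1 - i)) (A.L (-1) b)) =
        ((q + (1 - i) : ℤ) : ℂ) * B a (A.mode (A.fock w) (q + (1 - i) - 1) b) := by
      have h1 := A.L_neg_one_mode (q + (1 - i)) (A.fock w) b
      have h2 := hz (-1) (A.mode (A.fock w) (q + (1 - i)) b) (by norm_num)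
      rw [h1, map_add, map_smul, smul_eq_mul] at h2
      linear_combination h2
    have e2 : q + (1 - i) - 1 = ((w.sum : ℕ) : ℤ) - 1 := by
      rw [hq, List.sum_cons]; push_cast; ring
    have e3 : ((-1 : ℂ) ^ (1 - (i : ℤ))) = -(-1) ^ i := by
      rw [zpow_sub₀ (by norm_num), zpow_one, zpow_natCast]
      rcases neg_one_pow_eq_or ℂ i with h | h <;> rw [h] <;> norm_num
    simp only [Nat.cast_zero, Nat.cast_one, zero_sub, sub_zero, sub_self]
    rw [e1, A.mem_wt.1 hb.1, map_smul, map_smul, e2, ih fun n hn => hw n (by simp [hn]), e3,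
      casimirRho, Ring.choose_zero_right, Ring.choose_one_right, List.sum_cons, pow_add,
      show q + (1 - i) = ((w.sum : ℕ) : ℤ) by omega]
    push_cast
    simp only [smul_eq_mul]
    ring

end IsInvariantForm

end Pairs

end VOA

/-! ### Generating series of matrix elements -/

section Convolution

open PowerSeries

theorem finsum_mul_eq_coeff (E : ℕ → ℂ) (Φ : ℤ → ℂ) (hΦ : ∀ n < 0, Φ n = 0) (N : ℕ) :
    ∑ᶠ i : ℕ, E i * Φ (N - i) = coeff N (mk E * mk fun n : ℕ => Φ n) := by
  rw [finsum_eq_sum_of_support_subset (s := Finset.range (N + 1)), coeff_mul,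
    Finset.Nat.sum_antidiagonal_eq_sum_range_succ
      (fun i j => coeff i (mk E) * coeff j (mk fun n : ℕ => Φ n))]
  · refine Finset.sum_congr rfl fun i hi => ?_
    have : i ≤ N := Nat.lt_succ_iff.1 (Finset.mem_range.1 hi)
    rw [coeff_mk, coeff_mk, Nat.cast_sub this]
  · intro i hi
    simp only [Finset.coe_range, Set.mem_Iio]
    by_contra hlt
    exact hi (by simp only; rw [hΦ _ (by omega), mul_zero])

theorem finsum_oneSubZPow (r : ℤ) (Φ : ℤ → ℂ) (hΦ : ∀ n < 0, Φ n = 0) (N : ℕ) :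
    ∑ᶠ i : ℕ, ((-1 : ℂ) ^ i * (Ring.choose r i : ℤ)) * Φ (N - i) =
      coeff N (oneSubZPow ℂ r * mk fun n : ℕ => Φ n) := by
  rw [finsum_mul_eq_coeff _ _ hΦ]
  congr 2
  ext n
  rw [coeff_mk, coeff_oneSubZPow]

end Convolution

namespace VOA

section Series

variable {V : Type*} [AddCommGroup V] [Module ℂ V] {A : VOA V} {B : LinearMap.BilinForm ℂ V}
  {l : ℕ} {a b u v : V}

theorem finite_support_mode (A : VOA V) (u v : V) (p : ℤ) :
    (Function.support fun i : ℕ => A.mode u (p + i) v).Finite := by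
  obtain ⟨N, hN⟩ := A.exists_mode_eq_zero u v
  refine (Set.finite_Iio (N + p.natAbs)).subset fun j hj => ?_
  by_contra hlt
  exact hj (hN _ (by simp at hlt; omega))

/-- The Jacobi identity in matrix elements. -/
theorem jacobi_form (A : VOA V) (f : V →ₗ[ℂ] ℂ) (u v w : V) (p q r : ℤ) :
    ∑ᶠ i : ℕ, ((Ring.choose p i : ℤ) : ℂ) * f (A.mode (A.mode u (r + i) v) (p + q - i) w)
      = ∑ᶠ i : ℕ, ((-1 : ℂ) ^ i * (Ring.choose r i : ℤ)) *
          (f (A.mode u (p + r - i) (A.mode v (q + i) w))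
            - (-1 : ℂ) ^ r * f (A.mode v (q + r - i) (A.mode u (p + i) w))) := by
  have h := congrArg f (A.jacobi_mode u v w p q r)
  have hL : (Function.support fun i : ℕ =>
      Ring.choose p i • A.mode (A.mode u (r + i) v) (p + q - i) w).Finite := by
    refine (A.finite_support_mode u v r).subset fun i hi h0 => hi ?_
    simp only at h0 ⊢
    rw [h0, mode_zero]
    simp
  have hR : (Function.support fun i : ℕ => ((-1 : ℂ) ^ i * (Ring.choose r i : ℤ)) •
          (A.mode u (p + r - i) (A.mode v (q + i) w)
            - (-1 : ℂ) ^ r • A.mode v (q + r - i) (A.mode u (p + i) w))).Finite := by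
    refine ((A.finite_support_mode v w q).union (A.finite_support_mode u w p)).subset
      fun i hi => ?_
    by_contra hn
    simp only [Set.mem_union, Function.mem_support, not_or, not_not] at hn
    apply hi
    simp only
    rw [hn.1, hn.2]
    simp
  rw [← LinearMap.toAddMonoidHom_coe, AddMonoidHom.map_finsum _ hL, AddMonoidHom.map_finsum _ hR]
    at h
  simp only [LinearMap.toAddMonoidHom_coe, map_zsmul, map_smul, map_sub, zsmul_eq_mul,
    smul_eq_mul] at h
  exact h

/-- The matrix elements `⟨a, u(N - 1) v(2 l - 1 - N) b⟩`. -/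
def productElt (A : VOA V) (B : LinearMap.BilinForm ℂ V) (l : ℕ) (a b u v : V) (N : ℤ) : ℂ :=
  B a (A.mode u (N - 1) (A.mode v (2 * l - 1 - N) b))

/-- The matrix elements of the zero mode of `u(2 l - 1 - n) v`. -/
def iterateElt (A : VOA V) (B : LinearMap.BilinForm ℂ V) (l : ℕ) (a b u v : V) (n : ℤ) : ℂ :=
  B a (A.mode (A.mode u (2 * l - n - 1) v) (n - 1) b)

theorem productElt_neg (hC : A.IsStrongCFT) (hb : b ∈ A.primary l) (hv : v ∈ A.primary l)
    (a u : V) {N : ℤ} (hN : N < 0) : A.productElt B l a b u v N = 0 := by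
  have : A.mode v (2 * l - 1 - N) b = 0 :=
    eq_zero_of_mem_wt_neg hC hN (by
      rw [show 2 * (l : ℤ) - 1 - N = 2 * l - N - 1 by ring]; exact mode_primary_mem_wt hv hb N)
  rw [productElt, this]
  simp

theorem iterateElt_neg (hC : A.IsStrongCFT) (hu : u ∈ A.primary l) (hv : v ∈ A.primary l)
    (a b : V) {n : ℤ} (hn : n < 0) : A.iterateElt B l a b u v n = 0 := by
  rw [iterateElt, eq_zero_of_mem_wt_neg hC hn (mode_primary_mem_wt hu hv n), mode_zero]
  simp

/-- The generating series of `productElt`. -/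
def productSeries (A : VOA V) (B : LinearMap.BilinForm ℂ V) (l : ℕ) (a b u v : V) :
    PowerSeries ℂ :=
  PowerSeries.mk fun n : ℕ => A.productElt B l a b u v n

/-- The generating series of `iterateElt`, with alternating signs. -/
def iterateSeries (A : VOA V) (B : LinearMap.BilinForm ℂ V) (l : ℕ) (a b u v : V) :
    PowerSeries ℂ :=
  PowerSeries.mk fun n : ℕ => (-1) ^ n * A.iterateElt B l a b u v n

/-- The Jacobi identity with r = 2l: the iterates u(2l+i)v have negative weight, so one side is
zero. -/
theorem locality_finsum (hC : A.IsStrongCFT) (b : V) (hu : u ∈ A.primary l)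
    (hv : v ∈ A.primary l) (a : V) (M : ℤ) :
    ∑ᶠ i : ℕ, ((-1 : ℂ) ^ i * (Ring.choose (2 * l : ℤ) i : ℤ)) *
        (A.productElt B l a b u v (M - i)) =
      ∑ᶠ i : ℕ, ((-1 : ℂ) ^ i * (Ring.choose (2 * l : ℤ) i : ℤ)) *
        (A.productElt B l a b v u (4 * l - M - i)) := by
  have h := A.jacobi_form (B a) u v b (M - 2 * l - 1) (2 * l - 1 - M) (2 * l)
  have h0 : ∀ i : ℕ, A.mode u (2 * (l : ℤ) + i) v = 0 := fun i =>
    eq_zero_of_mem_wt_neg hC (n := -1 - i) (by omega) (by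
      rw [show 2 * (l : ℤ) + i = 2 * l - (-1 - i) - 1 by ring]; exact mode_primary_mem_wt hu hv _)
  have hfin : ∀ F : ℕ → ℂ, (Function.support fun i : ℕ =>
      ((-1 : ℂ) ^ i * (Ring.choose (2 * l : ℤ) i : ℤ)) * F i).Finite := fun F => by
    refine (Set.finite_Iio (2 * l + 1)).subset fun i hi => ?_
    by_contra hlt
    apply hi
    simp only [Set.mem_Iio] at hlt ⊢
    rw [show (2 * l : ℤ) = ((2 * l : ℕ) : ℤ) by push_cast; ring, Ring.choose_natCast,
      Nat.choose_eq_zero_of_lt (by omega)]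
    simp
  simp only [h0, mode_zero, LinearMap.zero_apply, map_zero, mul_zero, finsum_zero] at h
  have e : (-1 : ℂ) ^ (2 * l : ℤ) = 1 := by
    rw [zpow_mul]; norm_num
  simp only [e, one_mul, mul_sub] at h
  rw [finsum_sub_distrib (hfin _) (hfin _), eq_comm, sub_eq_zero] at h
  have h1 : ∀ i : ℕ, A.productElt B l a b u v (M - i) =
      B a (A.mode u (M - 2 * l - 1 + 2 * l - i) (A.mode v (2 * l - 1 - M + i) b)) := fun i => by
    rw [productElt, show M - i - 1 = M - 2 * l - 1 + 2 * l - i by ring,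
      show 2 * (l : ℤ) - 1 - (M - i) = 2 * l - 1 - M + i by ring]
  have h2 : ∀ i : ℕ, A.productElt B l a b v u (4 * l - M - i) =
      B a (A.mode v (2 * l - 1 - M + 2 * l - i) (A.mode u (M - 2 * l - 1 + i) b)) := fun i => by
    rw [productElt, show 4 * (l : ℤ) - M - i - 1 = 2 * l - 1 - M + 2 * l - i by ring,
      show 2 * (l : ℤ) - 1 - (4 * l - M - i) = M - 2 * l - 1 + i by ring]
  simp only [h1, h2]
  exact h

theorem coeff_locality (hC : A.IsStrongCFT) (hb : b ∈ A.primary l) (hu : u ∈ A.primary l)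
    (hv : v ∈ A.primary l) (a : V) {M N : ℕ} (hMN : M + N = 4 * l) :
    PowerSeries.coeff M (PowerSeries.oneSubZPow ℂ (2 * l) * A.productSeries B l a b u v) =
      PowerSeries.coeff N (PowerSeries.oneSubZPow ℂ (2 * l) * A.productSeries B l a b v u) := by
  have h := locality_finsum (B := B) hC b hu hv a M
  rw [show 4 * (l : ℤ) - M = (N : ℕ) by omega] at h
  rw [finsum_oneSubZPow _ _ fun n hn => productElt_neg hC hb hv a u hn,
    finsum_oneSubZPow _ _ fun n hn => productElt_neg hC hb hu a v hn] at h
  exact h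

theorem coeff_locality_eq_zero (hC : A.IsStrongCFT) (hb : b ∈ A.primary l) (hu : u ∈ A.primary l)
    (hv : v ∈ A.primary l) (a : V) {M : ℕ} (hM : 4 * l < M) :
    PowerSeries.coeff M (PowerSeries.oneSubZPow ℂ (2 * l) * A.productSeries B l a b u v) = 0 := by
  have h := locality_finsum (B := B) hC b hu hv a M
  rw [finsum_oneSubZPow _ _ fun n hn => productElt_neg hC hb hv a u hn] at h
  refine h.trans ?_
  refine finsum_eq_zero_of_forall_eq_zero fun i => ?_
  rw [productElt_neg hC hb hu a v (by omega), mul_zero]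

/-- The Jacobi identity with p = 2l: the terms v(·)u(2l+i)b vanish by weight, so iterates are
compared with one ordering of the product. -/
theorem coeff_associativity (hC : A.IsStrongCFT) (hb : b ∈ A.primary l) (hu : u ∈ A.primary l)
    (hv : v ∈ A.primary l) (a : V) {M N : ℕ} (hMN : M + N = 4 * l) :
    PowerSeries.coeff M (PowerSeries.oneSubZPow ℂ (2 * l) * A.iterateSeries B l a b u v) =
      (-1) ^ M * PowerSeries.coeff N
        (PowerSeries.oneSubZPow ℂ (2 * l - 1 - M) * A.productSeries B l a b u v) := by
  have h := A.jacobi_form (B a) u v b (2 * l) (M - 1 - 2 * l) (2 * l - 1 - M)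
  have h0 : ∀ i : ℕ, A.mode u (2 * (l : ℤ) + i) b = 0 := fun i =>
    eq_zero_of_mem_wt_neg hC (n := -1 - i) (by omega) (by
      rw [show 2 * (l : ℤ) + i = 2 * l - (-1 - i) - 1 by ring]; exact mode_primary_mem_wt hu hb _)
  simp only [h0, map_zero, mul_zero, sub_zero] at h
  have hR : ∑ᶠ i : ℕ, ((-1 : ℂ) ^ i * (Ring.choose (2 * l - 1 - M : ℤ) i : ℤ)) *
        (A.productElt B l a b u v ((N : ℕ) - i)) = PowerSeries.coeff N
        (PowerSeries.oneSubZPow ℂ (2 * l - 1 - M) * A.productSeries B l a b u v) :=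
    finsum_oneSubZPow _ _ (fun n hn => productElt_neg hC hb hv a u hn) N
  have hL : ∑ᶠ i : ℕ, ((-1 : ℂ) ^ i * (Ring.choose (2 * l : ℤ) i : ℤ)) *
        ((-1) ^ ((M : ℤ) - i) * A.iterateElt B l a b u v (M - i)) = PowerSeries.coeff M
        (PowerSeries.oneSubZPow ℂ (2 * l) * A.iterateSeries B l a b u v) := by
    have := finsum_oneSubZPow (2 * l) (fun n : ℤ => (-1) ^ n * A.iterateElt B l a b u v n)
      (fun n hn => by rw [iterateElt_neg hC hu hv a b hn, mul_zero]) M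
    simpa only [zpow_natCast, iterateSeries] using this
  rw [← hL, ← hR]
  have h1 : ∀ i : ℕ, ((-1 : ℂ) ^ i * (Ring.choose (2 * l : ℤ) i : ℤ)) *
        ((-1) ^ ((M : ℤ) - i) * A.iterateElt B l a b u v (M - i)) =
      (-1) ^ M * (((Ring.choose (2 * l : ℤ) i : ℤ) : ℂ) *
        B a (A.mode (A.mode u (2 * l - 1 - M + i) v) (2 * l + (M - 1 - 2 * l) - i) b)) := by
    intro i
    rw [iterateElt, zpow_sub₀ (by norm_num), zpow_natCast, zpow_natCast,
      show 2 * (l : ℤ) - (M - i) - 1 = 2 * l - 1 - M + i by ring,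
      show (M : ℤ) - i - 1 = 2 * l + (M - 1 - 2 * l) - i by ring]
    have : (-1 : ℂ) ^ i ≠ 0 := pow_ne_zero _ (by norm_num)
    field_simp
  have h2 : ∀ i : ℕ, A.productElt B l a b u v ((N : ℕ) - i) =
      B a (A.mode u (2 * l + (2 * l - 1 - M) - i) (A.mode v (M - 1 - 2 * l + i) b)) := by
    intro i
    rw [productElt, show ((N : ℕ) : ℤ) = 4 * l - M by omega]
    congr 3
    · ring
    · congr 1; ring
  simp only [h1, h2]
  rw [← h]
  exact (smul_finsum ((-1 : ℂ) ^ M) _).symm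

end Series

end VOA

/-! ### Determination of a palindromic polynomial by its two expansions -/

namespace PowerSeries

theorem coeff_mul_congr {R : Type*} [CommRing R] (Q : PowerSeries R) {S T : PowerSeries R} {N : ℕ}
    (h : ∀ n ≤ N, coeff n S = coeff n T) : coeff N (Q * S) = coeff N (Q * T) := by
  rw [coeff_mul, coeff_mul]
  refine Finset.sum_congr rfl fun x hx => ?_
  have := Finset.HasAntidiagonal.mem_antidiagonal.1 hx
  rw [h x.2 (by omega)]

theorem eq_oneSubZPow_mul {R : Type*} [CommRing R] {r : ℤ} {Φ P : PowerSeries R}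
    (h : oneSubZPow R r * Φ = P) : Φ = oneSubZPow R (-r) * P := by
  rw [← h, ← mul_assoc, ← oneSubZPow_add, neg_add_cancel, oneSubZPow_zero, one_mul]

variable {l : ℕ} {Φ : PowerSeries ℂ} {g : ℕ → ℂ}

/-- Dividing by (1-X)^(2l) gives Φ = (1-X)^(2l) Σ g_(2l-i) s^i with s = X/(1-X)^2. The coefficient
of s^j needs Φ only up to order j. -/
theorem koebe_coeff_of_expansion
    (hP : oneSubZPow ℂ (2 * l) * Φ =
      ∑ k ∈ Finset.range (2 * l + 1), C (g k) * ((1 - X) ^ (2 * k) * X ^ (2 * l - k)))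
    {S : PowerSeries ℂ} {α : ℂ} (hΦ : ∀ n < l, coeff n Φ = α * coeff n S) {j : ℕ} (hj : j < l) :
    g (2 * l - j) =
      α * coeff j ((1 + X) * oneSubZPow ℂ (-((2 * l + 1 - 2 * j : ℕ) : ℤ)) * S) := by
  have h1 := coeff_mul_congr ((1 + X) * oneSubZPow ℂ (-((2 * l + 1 - 2 * j : ℕ) : ℤ)))
    (S := Φ) (T := C α * S) (N := j) (fun n hn => by rw [coeff_C_mul]; exact hΦ n (by omega))
  rw [← coeff_C_mul, mul_left_comm, ← h1]
  have h2 : Φ = oneSubZPow ℂ (2 * l) * ∑ i ∈ Finset.range (2 * l + 1),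
      C (g (2 * l - i)) * (X ^ i * oneSubZPow ℂ (-(2 * i))) := by
    rw [eq_oneSubZPow_mul hP, Finset.mul_sum, Finset.mul_sum, ← Finset.sum_range_reflect]
    refine Finset.sum_congr rfl fun i hi => ?_
    have hi' : i ≤ 2 * l := Nat.lt_succ_iff.1 (Finset.mem_range.1 hi)
    rw [show 2 * l + 1 - 1 - i = 2 * l - i by omega, show 2 * l - (2 * l - i) = i by omega,
      ← oneSubZPow_natCast]
    have : oneSubZPow ℂ (-(2 * (l : ℤ))) * oneSubZPow ℂ ((2 * (2 * l - i) : ℕ) : ℤ) =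
        oneSubZPow ℂ (2 * l) * oneSubZPow ℂ (-(2 * i)) := by
      rw [← oneSubZPow_add, ← oneSubZPow_add]
      congr 1
      push_cast [Nat.cast_sub hi']
      ring
    linear_combination (C (g (2 * l - i)) * X ^ i) * this
  have h3 := coeff_series_in_koebe (R := ℂ) (2 * l + 1) j (by omega) fun i => g (2 * l - i)
  have e : oneSubZPow ℂ (2 * j - 1) =
      oneSubZPow ℂ (-((2 * l + 1 - 2 * j : ℕ) : ℤ)) * oneSubZPow ℂ (2 * l) := by
    rw [← oneSubZPow_add]
    congr 1
    omega
  rw [← h3, e]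
  conv_rhs => rw [h2]
  congr 1
  ring

/-- The binomial identity behind the comparison of the expansions at `z = 0` and `z = 1`. -/
theorem coeff_reexpansion (l k : ℕ) (hk : k ≤ 2 * l) {M N : ℕ} (hMN : M + N = 4 * l) :
    (-1) ^ M * coeff N (X ^ (2 * l - k) * oneSubZPow ℂ (2 * k - 1 - M)) =
      coeff M (X ^ (2 * k) * oneSubZPow ℂ (2 * l - k)) := by
  have e : (2 * l - k : ℤ) = ((2 * l - k : ℕ) : ℤ) := by omega
  rw [coeff_X_pow_mul', coeff_X_pow_mul', e, coeff_oneSubZPow_natCast]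
  rcases le_or_gt (2 * k) M with h | h
  · rw [if_pos h, show (2 * k - 1 - M : ℤ) = -(((M - 2 * k : ℕ) : ℤ) + 1) by omega,
      coeff_oneSubZPow_neg]
    have hs : (-1 : ℂ) ^ M = (-1) ^ (M - 2 * k) := by
      rw [neg_one_pow_eq_pow_mod_two, neg_one_pow_eq_pow_mod_two (n := M - 2 * k)]
      congr 1
      omega
    split_ifs with h'
    · rw [hs, show M - 2 * k + (N - (2 * l - k)) = 2 * l - k by omega]
    · rw [Nat.choose_eq_zero_of_lt (by omega)]; simp
  -- For M < 2k the exponent is a natural number and the requested degree exceeds it, so both sides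
  -- vanish.
  · rw [if_neg (show ¬ 2 * k ≤ M by omega), show (2 * k - 1 - M : ℤ) = ((2 * k - 1 - M : ℕ) : ℤ) by omega,
      coeff_oneSubZPow_natCast]
    split_ifs with h'
    · rw [Nat.choose_eq_zero_of_lt (by omega)]; simp
    · simp

/-- Re-expanding term by term, T agrees with Σ g_i t^i, t = X^2/(1-X), up to degree 4l. The bound l
≥ 1 ensures 2l + 2 ≤ 4l, so that k = l + 1 is still within reach. -/
theorem quadratic_coeff_of_expansion (hl : 1 ≤ l)
    (hP : oneSubZPow ℂ (2 * l) * Φ =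
      ∑ k ∈ Finset.range (2 * l + 1), C (g k) * ((1 - X) ^ (2 * k) * X ^ (2 * l - k)))
    {T S : PowerSeries ℂ} {α : ℂ}
    (hT : ∀ M N : ℕ, M + N = 4 * l → coeff M (oneSubZPow ℂ (2 * l) * T) =
      (-1) ^ M * coeff N (oneSubZPow ℂ (2 * l - 1 - M) * Φ))
    (hTS : ∀ n ≤ 2 * l + 2, coeff n T = α * coeff n S) {k : ℕ} (hk : k ≤ l + 1) :
    g k = α * coeff (2 * k) ((1 - C (1 / 2 : ℂ) * X) * (1 - X) ^ (k - 1) * S) := by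
  set Q : PowerSeries ℂ := ∑ i ∈ Finset.range (2 * l + 1),
    C (g i) * (X ^ (2 * i) * oneSubZPow ℂ (-i)) with hQ
  have h1 : ∀ M ≤ 4 * l, coeff M (oneSubZPow ℂ (2 * l) * T) =
      coeff M (oneSubZPow ℂ (2 * l) * Q) := by
    intro M hM
    rw [hT M (4 * l - M) (by omega), eq_oneSubZPow_mul hP, ← mul_assoc, ← oneSubZPow_add, hQ,
      Finset.mul_sum, Finset.mul_sum, map_sum, map_sum, Finset.mul_sum]
    refine Finset.sum_congr rfl fun i hi => ?_
    have hi' : i ≤ 2 * l := Nat.lt_succ_iff.1 (Finset.mem_range.1 hi)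
    have e1 : oneSubZPow ℂ (2 * l - 1 - M + -(2 * l)) *
        (C (g i) * ((1 - X) ^ (2 * i) * X ^ (2 * l - i))) =
        C (g i) * (X ^ (2 * l - i) * oneSubZPow ℂ (2 * i - 1 - M)) := by
      rw [← oneSubZPow_natCast, show (2 * i - 1 - M : ℤ) =
        (2 * l - 1 - M + -(2 * l)) + ((2 * i : ℕ) : ℤ) by push_cast; ring,
        oneSubZPow_add _ ((2 * i : ℕ) : ℤ)]
      ring
    have e2 : oneSubZPow ℂ (2 * l) * (C (g i) * (X ^ (2 * i) * oneSubZPow ℂ (-i))) =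
        C (g i) * (X ^ (2 * i) * oneSubZPow ℂ (2 * l - i)) := by
      rw [sub_eq_add_neg, oneSubZPow_add]
      ring
    rw [e1, e2, coeff_C_mul, coeff_C_mul, ← coeff_reexpansion l i hi' (N := 4 * l - M) (by omega)]
    ring
  have h2 : ∀ M ≤ 4 * l, coeff M T = coeff M Q := by
    intro M hM
    rw [eq_oneSubZPow_mul (rfl : oneSubZPow ℂ (2 * l) * T = _),
      eq_oneSubZPow_mul (rfl : oneSubZPow ℂ (2 * l) * Q = _)]
    exact coeff_mul_congr _ fun n hn => h1 n (hn.trans hM)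
  have h3 := coeff_series_in_quadratic (R := ℂ) (2 * l + 1) k (by omega) g
  rw [← h3, ← coeff_C_mul, mul_left_comm]
  refine coeff_mul_congr _ fun n hn => ?_
  rw [coeff_C_mul, ← hTS n (by omega), h2 n (by omega)]

end PowerSeries

/-! ### The genus zero correlation function -/

namespace VOA

/-! ### Dual bases of the space of primary vectors -/

section DualBasis

variable {V : Type*} [AddCommGroup V] [Module ℂ V] {A : VOA V} {B : LinearMap.BilinForm ℂ V}
  {l : ℕ} {u : Module.Basis (Fin (A.primaryDim l)) ℂ (A.primary l)}
  {u' : Fin (A.primaryDim l) → A.primary l}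

namespace IsDualBasis

theorem repr_eq (hd : A.IsDualBasis B l u u') (hB : A.IsInvariantForm B) (x : A.primary l)
    (i : Fin (A.primaryDim l)) : u.repr x i = B (u' i : V) (x : V) := by
  have hx : (x : V) = ∑ j, u.repr x j • (u j : V) := by
    have := congrArg Subtype.val (u.sum_repr x)
    simp only [Submodule.coe_sum, Submodule.coe_smul] at this
    exact this.symm
  conv_rhs => rw [hx]
  rw [map_sum, Finset.sum_eq_single i]
  · rw [map_smul, hB.1, hd i i, if_pos rfl, smul_eq_mul, mul_one]
  · intro j _ hj
    rw [map_smul, hB.1, hd j i, if_neg hj, smul_zero]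
  · simp

theorem eq_sum (hd : A.IsDualBasis B l u u') (hB : A.IsInvariantForm B) {x : V}
    (hx : x ∈ A.primary l) : x = ∑ i, B (u' i : V) x • (u i : V) := by
  have := congrArg (Subtype.val) (u.sum_repr ⟨x, hx⟩)
  simp only [Submodule.coe_sum, Submodule.coe_smul, hd.repr_eq hB] at this
  exact this.symm

theorem sum_pairing (hd : A.IsDualBasis B l u u') (hB : A.IsInvariantForm B) {x : V}
    (hx : x ∈ A.primary l) (y : V) : ∑ i, B (u i : V) y * B (u' i : V) x = B x y := by
  conv_rhs => rw [hd.eq_sum hB hx]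
  rw [map_sum, LinearMap.sum_apply]
  refine Finset.sum_congr rfl fun i _ => ?_
  rw [map_smul, LinearMap.smul_apply, smul_eq_mul, mul_comm]

/-- Expanding the dual basis in the basis exhibits the Casimir tensor through the symmetric matrix
⟨ū_j, ū_i⟩. -/
theorem sum_symm (hd : A.IsDualBasis B l u u') (hB : A.IsInvariantForm B)
    (f : V →ₗ[ℂ] V →ₗ[ℂ] ℂ) :
    ∑ i, f (u i : V) (u' i : V) = ∑ i, f (u' i : V) (u i : V) := by
  have h1 : ∀ i, f (u i : V) (u' i : V) =
      ∑ j, B (u' j : V) (u' i : V) * f (u i : V) (u j : V) := fun i => by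
    conv_lhs => enter [2]; rw [hd.eq_sum hB (u' i).2]
    simp
  have h2 : ∀ i, f (u' i : V) (u i : V) =
      ∑ j, B (u' j : V) (u' i : V) * f (u j : V) (u i : V) := fun i => by
    conv_lhs => enter [1]; rw [hd.eq_sum hB (u' i).2]
    simp
  simp only [h1, h2]
  rw [Finset.sum_comm]
  refine Finset.sum_congr rfl fun i _ => Finset.sum_congr rfl fun j _ => ?_
  rw [hB.1]

theorem sum_self (hd : A.IsDualBasis B l u u') :
    ∑ i, B (u i : V) (u' i : V) = A.primaryDim l := by
  simp [hd _ _]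

end IsDualBasis

namespace IsExceptional

/-- Every vector of V_l is a descendant plus a primary vector, and primaries are orthogonal to
descendants. Nondegeneracy on V_l therefore passes to Π_l. -/
theorem eq_zero_of_primary_orthogonal (hE : A.IsExceptional B l) {a : V} (ha : a ∈ A.primary l)
    (h : ∀ b ∈ A.primary l, B b a = 0) : a = 0 := by
  have hB := hE.form
  refine hB.eq_zero_of_forall_wt hE.simple (A.mem_primary.1 ha).1 fun x hx => ?_
  obtain ⟨s, hs, p, hp, rfl⟩ := hB.exists_add_primary hE.strongCFT hE.noSingular (by omega)
    (fun j hj => hB.wt_le_virasoroSub hE.strongCFT hE.noSingular (by omega) hE.lowest j hj) hx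
  rw [map_add, LinearMap.add_apply, hB.primary_orthogonal hE.one_le ha hs, h p hp, add_zero]

theorem exists_dualBasis (hE : A.IsExceptional B l) :
    ∃ (u : Module.Basis (Fin (A.primaryDim l)) ℂ (A.primary l))
      (u' : Fin (A.primaryDim l) → A.primary l), A.IsDualBasis B l u u' := by
  have hfd : FiniteDimensional ℂ (A.wt l) := A.finite_weight l
  have hfd' : FiniteDimensional ℂ (A.primary l) :=
    Submodule.finiteDimensional_of_le (inf_le_left : A.primary l ≤ A.wt l)
  let u : Module.Basis (Fin (A.primaryDim l)) ℂ (A.primary l) := Module.finBasis ℂ (A.primary l)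
  let B' : LinearMap.BilinForm ℂ (A.primary l) := B.restrict (A.primary l)
  have hB' : ∀ x y : A.primary l, B' x y = B (x : V) (y : V) := fun x y => rfl
  have hnd : B'.Nondegenerate := by
    constructor
    · intro x hx
      refine Subtype.ext (hE.eq_zero_of_primary_orthogonal x.2 fun b hb => ?_)
      rw [hE.form.1]
      exact hx ⟨b, hb⟩
    · intro x hx
      exact Subtype.ext (hE.eq_zero_of_primary_orthogonal x.2 fun b hb => hx ⟨b, hb⟩)
  refine ⟨u, B'.dualBasis hnd u, fun i j => ?_⟩
  rw [hE.form.1, ← hB', LinearMap.BilinForm.apply_dualBasis_left]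

end IsExceptional

end DualBasis

/-! ### Matching the correlation function with the Virasoro vacuum blocks -/

section Correlation

variable {V : Type*} [AddCommGroup V] [Module ℂ V] {A : VOA V} {B : LinearMap.BilinForm ℂ V}
  {l : ℕ} {u : Module.Basis (Fin (A.primaryDim l)) ℂ (A.primary l)}
  {u' : Fin (A.primaryDim l) → A.primary l} {a b : V}

namespace IsExceptional

theorem L_casimir (u : Module.Basis (Fin (A.primaryDim l)) ℂ (A.primary l))
    (u' : Fin (A.primaryDim l) → A.primary l) {m : ℕ} (hm : 1 ≤ m) (n : ℕ) :
    A.L m (A.casimir l u u' (n + m)) = ((n : ℂ) + l * (m - 1)) • A.casimir l u u' n := by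
  rw [casimir, casimir, map_sum, Finset.smul_sum]
  refine Finset.sum_congr rfl fun i _ => ?_
  rw [L_mode_primary_primary (u i).2 (u' i).2 (by omega)]
  congr 2
  · push_cast; ring
  · congr 1; push_cast; ring

/-- L(m) maps the Casimir vector of weight 2l+2 = n+m to n + l(m-1) times the one of weight n. The
factor could vanish only for n = 0 and m = 1, which is excluded by n + m = 2l + 2. -/
theorem casimir_mem_virasoroSub (hE : A.IsExceptional B l) (hd : A.IsDualBasis B l u u') {n : ℕ}
    (hn : n ≤ 2 * l + 2) : A.casimir l u u' n ∈ A.virasoroSub := by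
  have h := hE.casimir_mem u u' hd
  obtain ⟨m, hm⟩ := Nat.exists_eq_add_of_le hn
  rcases Nat.eq_zero_or_pos m with rfl | hpos
  · rwa [hm] at h
  · have h1 := A.L_mem_virasoroSub h m
    rw [hm, L_casimir u u' hpos] at h1
    refine (Submodule.smul_mem_iff _ ?_).1 h1
    have : ((n : ℂ) + l * (m - 1)) = ((n + l * (m - 1) : ℕ) : ℂ) := by
      push_cast [Nat.cast_sub hpos]; ring
    rw [this, Nat.cast_ne_zero]
    intro h0
    have hn0 : n = 0 := by omega
    have : l * (m - 1) = 0 := by omega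
    rcases Nat.mul_eq_zero.1 this with h | h
    · have := hE.one_le; omega
    · omega

theorem casimir_mem_wt (u : Module.Basis (Fin (A.primaryDim l)) ℂ (A.primary l))
    (u' : Fin (A.primaryDim l) → A.primary l) (n : ℕ) : A.casimir l u u' n ∈ A.wt n :=
  Submodule.sum_mem _ fun i _ => mode_primary_mem_wt (u i).2 (u' i).2 n

theorem sum_iterateElt (hE : A.IsExceptional B l) (hd : A.IsDualBasis B l u u')
    (ha : a ∈ A.primary l) (hb : b ∈ A.primary l) {n : ℕ} (hn : n ≤ 2 * l + 2) :
    (-1) ^ n * ∑ i, A.iterateElt B l a b (u i) (u' i) n =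
      (-1) ^ l * B a b * A.primaryDim l * blockVal A.c l n := by
  have hB := hE.form
  let f : V →ₗ[ℂ] ℂ := (B a) ∘ₗ (LinearMap.applyₗ b) ∘ₗ A.modeHom ((n : ℤ) - 1)
  have hf : ∀ x, f x = B a (A.mode x ((n : ℤ) - 1) b) := fun _ => rfl
  have h1 : ∑ i, A.iterateElt B l a b (u i) (u' i) n = f (A.casimir l u u' n) := by
    rw [casimir, map_sum]
    rfl
  rw [h1, hB.eq_blockVal hE.strongCFT hE.noSingular hn (hE.casimir_mem_virasoroSub hd hn)
    (casimir_mem_wt u u' n) f l ((-1) ^ l * A.primaryDim l) ((-1) ^ n * B a b)]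
  · have : ((-1 : ℂ) ^ n) * (-1) ^ n = 1 := by rw [← mul_pow]; simp
    linear_combination ((-1) ^ l * B a b * A.primaryDim l * blockVal A.c l n) * this
  · intro P
    rw [casimir, map_sum, ← hd.sum_self, Finset.mul_sum, Finset.mul_sum]
    exact Finset.sum_congr rfl fun i _ => hB.fock_pairing_primary (u i).2 (u' i).2 P
  · intro P
    have := hB.fock_mode_primary ha hb P.list fun k hk => P.two_le hk
    rw [P.sum_list] at this
    rw [hf, this]

/-- Moving u_i to the left factor leaves two vectors of weight n < l, where V_n lies in V_ω. The sum
over i is then completeness of the dual bases, so no factor p_l appears. -/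
theorem sum_productElt (hE : A.IsExceptional B l) (hd : A.IsDualBasis B l u u')
    (ha : a ∈ A.primary l) (hb : b ∈ A.primary l) {n : ℕ} (hn : n < l) :
    ∑ i, A.productElt B l a b (u i) (u' i) n = (-1) ^ l * B a b * blockVal A.c l n := by
  have hB := hE.form
  have h1 : ∀ i, A.productElt B l a b (u i) (u' i) n =
      (-1) ^ l * (B (u i : V) a * B (u' i : V) b) * blockVal A.c l n := by
    intro i
    have hwt := mode_primary_mem_wt (u i).2 ha n
    have h2 : (n : ℕ) ≤ 2 * l + 2 := by omega
    have := hB.eq_blockVal hE.strongCFT hE.noSingular h2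
      (hB.wt_le_virasoroSub hE.strongCFT hE.noSingular (by omega) hE.lowest n hn hwt) hwt
      (B.flip (A.mode (u' i : V) (2 * l - n - 1) b)) l ((-1) ^ l * B (u i : V) a)
      ((-1) ^ l * B (u' i : V) b) (hB.fock_pairing_primary (u i).2 ha)
      (hB.fock_pairing_primary (u' i).2 hb)
    rw [productElt, hB.primary_adjoint (u i).2,
      show 2 * (l : ℤ) - (n - 1) - 2 = 2 * l - n - 1 by ring,
      show 2 * (l : ℤ) - 1 - n = 2 * l - n - 1 by ring]
    change B _ _ = _ at this
    rw [this]
    have hs : ((-1 : ℂ) ^ l) * (-1) ^ l = 1 := by rw [← mul_pow]; simp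
    linear_combination ((-1) ^ l * (B (u i : V) a * B (u' i : V) b) * blockVal A.c l n) * hs
  simp only [h1]
  rw [← Finset.sum_mul, ← Finset.mul_sum, hd.sum_pairing hB hb a, hB.1]

/-- The generating series of the matrix elements of the correlation function. -/
theorem exists_expansion (hE : A.IsExceptional B l) (hd : A.IsDualBasis B l u u')
    (ha : a ∈ A.primary l) (hb : b ∈ A.primary l) :
    ∃ g : ℕ → ℂ,
      PowerSeries.oneSubZPow ℂ (2 * l) * ∑ i, A.productSeries B l a b (u i) (u' i) =
        ∑ k ∈ Finset.range (2 * l + 1), PowerSeries.C (g k) *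
          ((1 - PowerSeries.X) ^ (2 * k) * PowerSeries.X ^ (2 * l - k)) ∧
      (∀ k ≤ l + 1, g k = (-1) ^ l * B a b * A.primaryDim l * vVal A.c l k) ∧
      ∀ j < l, g (2 * l - j) = (-1) ^ l * B a b * wVal A.c l j := by
  have hB := hE.form
  have hC := hE.strongCFT
  set Φ := ∑ i, A.productSeries B l a b (u i) (u' i) with hΦ
  -- Locality exchanges u and ū; this symmetry turns it into palindromy of a single series.
  have hsymm : Φ = ∑ i, A.productSeries B l a b (u' i) (u i) := by
    ext n
    let f : V →ₗ[ℂ] V →ₗ[ℂ] ℂ := LinearMap.mk₂ ℂ (fun x y => A.productElt B l a b x y n)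
      (fun x y z => by simp [productElt, mode_add])
      (fun r x y => by simp [productElt, mode_smul])
      (fun x y z => by simp [productElt, mode_add])
      (fun r x y => by simp [productElt, mode_smul])
    rw [hΦ, map_sum, map_sum]
    have := hd.sum_symm hB f
    simp only [productSeries, PowerSeries.coeff_mk]
    exact this
  obtain ⟨g, hg⟩ := exists_expansion_of_palindromic (2 * l)
    (PowerSeries.oneSubZPow ℂ (2 * l) * Φ)
    (fun n hn => by
      rw [hΦ, Finset.mul_sum, map_sum]
      exact Finset.sum_eq_zero fun i _ =>
        coeff_locality_eq_zero hC hb (u i).2 (u' i).2 a (by omega))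
    (fun i j hij => by
      conv_rhs => rw [hsymm]
      rw [hΦ, Finset.mul_sum, map_sum, Finset.mul_sum, map_sum]
      exact Finset.sum_congr rfl fun k _ =>
        coeff_locality hC hb (u k).2 (u' k).2 a (by omega))
  refine ⟨g, hg, fun k hk => ?_, fun j hj => ?_⟩
  · refine PowerSeries.quadratic_coeff_of_expansion hE.one_le hg
      (T := ∑ i, A.iterateSeries B l a b (u i) (u' i)) ?_ ?_ hk
    · intro M N hMN
      rw [hΦ, Finset.mul_sum, map_sum, Finset.mul_sum, map_sum, Finset.mul_sum]
      exact Finset.sum_congr rfl fun k _ =>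
        coeff_associativity hC hb (u k).2 (u' k).2 a hMN
    · intro n hn
      rw [PowerSeries.coeff_mk, ← hE.sum_iterateElt hd ha hb hn, map_sum, Finset.mul_sum]
      exact Finset.sum_congr rfl fun k _ => PowerSeries.coeff_mk _ _
  · refine PowerSeries.koebe_coeff_of_expansion hg ?_ hj
    intro n hn
    rw [PowerSeries.coeff_mk, ← hE.sum_productElt hd ha hb hn, hΦ, map_sum]
    exact Finset.sum_congr rfl fun k _ => PowerSeries.coeff_mk _ _

end IsExceptional

end Correlation

end VOA

/-! ### Expansion of rational functions in two variables -/

section Expansion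

open PowerSeries

theorem genusZeroPoly_isSymmetric (l p : ℕ) (c : ℂ) : (genusZeroPoly l p c).IsSymmetric := by
  have hX : ∀ e : Equiv.Perm (Fin 2),
      (MvPolynomial.X (e 0) * MvPolynomial.X (e 1) : MvPolynomial (Fin 2) ℂ) =
        MvPolynomial.X 0 * MvPolynomial.X 1 := fun e => by
    have := Equiv.prod_comp e (fun i => (MvPolynomial.X i : MvPolynomial (Fin 2) ℂ))
    simpa [Fin.prod_univ_two] using this
  have hD : ∀ (e : Equiv.Perm (Fin 2)) (k : ℕ),
      (MvPolynomial.X (e 0) - MvPolynomial.X (e 1) : MvPolynomial (Fin 2) ℂ) ^ (2 * k) =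
        (MvPolynomial.X 0 - MvPolynomial.X 1) ^ (2 * k) := fun e k => by
    rw [pow_mul, pow_mul]
    congr 1
    have h1 := hX e
    have h2 := Equiv.sum_comp e (fun i => (MvPolynomial.X i : MvPolynomial (Fin 2) ℂ))
    simp only [Fin.sum_univ_two] at h2
    linear_combination (MvPolynomial.X (e 0) + MvPolynomial.X (e 1) + MvPolynomial.X 0 +
      MvPolynomial.X 1) * h2 - 4 * h1
  have hD' : ∀ (e : Equiv.Perm (Fin 2)) (j : ℕ),
      (MvPolynomial.X (e 0) - MvPolynomial.X (e 1) : MvPolynomial (Fin 2) ℂ) ^ (4 * l - 2 * j) =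
        (MvPolynomial.X 0 - MvPolynomial.X 1) ^ (4 * l - 2 * j) := fun e j => by
    rw [show 4 * l - 2 * j = 2 * (2 * l - j) by omega, hD]
  intro e
  simp only [genusZeroPoly, map_mul, map_add, map_sum, map_pow, map_neg, map_one, map_sub,
    MvPolynomial.rename_C, MvPolynomial.rename_X, hX, hD, hD']

theorem genusZeroPoly_isHomogeneous (l p : ℕ) (c : ℂ) :
    (genusZeroPoly l p c).IsHomogeneous (4 * l) := by
  have hd : (MvPolynomial.X 0 - MvPolynomial.X 1 : MvPolynomial (Fin 2) ℂ).IsHomogeneous 1 :=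
    (MvPolynomial.isHomogeneous_X ℂ 0).sub (MvPolynomial.isHomogeneous_X ℂ 1)
  have hm : (MvPolynomial.X 0 * MvPolynomial.X 1 : MvPolynomial (Fin 2) ℂ).IsHomogeneous 2 :=
    (MvPolynomial.isHomogeneous_X ℂ 0).mul (MvPolynomial.isHomogeneous_X ℂ 1)
  have hmon : ∀ (r : ℂ) (i j : ℕ), i + 2 * j = 4 * l →
      (MvPolynomial.C r * (MvPolynomial.X 0 - MvPolynomial.X 1) ^ i *
        (MvPolynomial.X 0 * MvPolynomial.X 1) ^ j : MvPolynomial (Fin 2) ℂ).IsHomogeneous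
          (4 * l) := fun r i j h => by
    have := ((MvPolynomial.isHomogeneous_C (Fin 2) r).mul (hd.pow i)).mul (hm.pow j)
    convert this using 1
    omega
  have hone : ((-1) ^ l : MvPolynomial (Fin 2) ℂ) = MvPolynomial.C ((-1) ^ l) := by simp
  rw [genusZeroPoly, hone]
  refine MvPolynomial.IsHomogeneous.C_mul (.add (.C_mul (.sum _ _ _ fun k hk => ?_) _)
    (.sum _ _ _ fun j hj => ?_)) _
  · have := Finset.mem_range.1 hk
    exact hmon _ _ _ (by omega)
  · have := Finset.mem_range.1 hj
    exact hmon _ _ _ (by omega)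

/-- The dehomogenisation `x = 1`, `y = z`. -/
noncomputable def dehomogenise (G : MvPolynomial (Fin 2) ℂ) : PowerSeries ℂ :=
  MvPolynomial.aeval ![1, X] G

theorem dehomogenise_eq_sum (G : MvPolynomial (Fin 2) ℂ) :
    dehomogenise G = ∑ d ∈ G.support, C (MvPolynomial.coeff d G) * X ^ d 1 := by
  rw [dehomogenise, MvPolynomial.aeval_def, MvPolynomial.eval₂_eq']
  refine Finset.sum_congr rfl fun d _ => ?_
  rw [Fin.prod_univ_two]
  simp

theorem expansionCoeff_eq_zero {l : ℕ} {G : MvPolynomial (Fin 2) ℂ} (hG : G.IsHomogeneous (4 * l))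
    {i j : ℤ} (h : ¬ (i + j = -2 * l ∧ 0 ≤ -i)) : expansionCoeff l G i j = 0 := by
  rw [expansionCoeff]
  refine Finset.sum_eq_zero fun d hd => ?_
  have hdeg := hG (MvPolynomial.mem_support_iff.1 hd)
  rw [Finsupp.weight_apply, Finsupp.sum_fintype _ _ (by simp), Fin.sum_univ_two] at hdeg
  simp at hdeg
  refine finsum_eq_zero_of_forall_eq_zero fun k => ?_
  rw [if_neg]
  omega

/-- By homogeneity a monomial is known from its y-degree, so the expansion for |x| > |y| is the one
in z = y/x; only k = N - d 1 contributes. -/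
theorem expansionCoeff_eq {l : ℕ} (hl : 1 ≤ l) {G : MvPolynomial (Fin 2) ℂ}
    (hG : G.IsHomogeneous (4 * l)) (N : ℕ) :
    expansionCoeff l G (-N) (N - 2 * l) =
      coeff N (oneSubZPow ℂ (-(2 * l)) * dehomogenise G) := by
  rw [expansionCoeff, dehomogenise_eq_sum, Finset.mul_sum, map_sum]
  refine Finset.sum_congr rfl fun d hd => ?_
  have hdeg := hG (MvPolynomial.mem_support_iff.1 hd)
  rw [Finsupp.weight_apply, Finsupp.sum_fintype _ _ (by simp), Fin.sum_univ_two] at hdeg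
  simp at hdeg
  rw [mul_left_comm, coeff_C_mul, mul_comm (oneSubZPow ℂ _), coeff_X_pow_mul',
    show (-(2 * (l : ℤ))) = -(((2 * l - 1 : ℕ) : ℤ) + 1) by omega, coeff_oneSubZPow_neg]
  rw [finsum_eq_single _ (N - d 1)]
  · split_ifs with h1 h2 h2
    · rw [Nat.choose_symm_add]
    · omega
    · omega
    · simp
  · intro k hk
    rw [if_neg]
    omega

theorem dehomogenise_genusZeroPoly {l p : ℕ} {c α : ℂ} {g : ℕ → ℂ}
    (hv : ∀ k ≤ l, g k = (-1) ^ l * α * p * evalC (vCoeff l k) c)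
    (hw : ∀ j < l, g (2 * l - j) = (-1) ^ l * α * evalC (wCoeff l j) c) :
    dehomogenise (MvPolynomial.C α * genusZeroPoly l p c) =
      ∑ k ∈ Finset.range (2 * l + 1), C (g k) * ((1 - X) ^ (2 * k) * X ^ (2 * l - k)) := by
  rw [show 2 * l + 1 = (l + 1) + l by ring, Finset.sum_range_add]
  simp only [dehomogenise, genusZeroPoly, map_mul, map_add, map_sum, map_pow, map_neg, map_one,
    map_sub, MvPolynomial.aeval_C, MvPolynomial.aeval_X, Matrix.cons_val_zero, Matrix.cons_val_one,
    one_mul, PowerSeries.algebraMap_apply, Algebra.algebraMap_self, RingHom.id_apply]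
  rw [← mul_assoc, mul_add]
  congr 1
  · rw [Finset.mul_sum, Finset.mul_sum]
    refine Finset.sum_congr rfl fun k hk => ?_
    rw [hv k (Nat.lt_succ_iff.1 (Finset.mem_range.1 hk))]
    simp only [map_mul, map_pow, map_neg, map_one]
    ring
  · rw [Finset.mul_sum, ← Finset.sum_range_reflect]
    refine Finset.sum_congr rfl fun k hk => ?_
    have hk' := Finset.mem_range.1 hk
    have e : l + 1 + k = 2 * l - (l - 1 - k) := by omega
    rw [e, hw (l - 1 - k) (by omega), show 2 * (2 * l - (l - 1 - k)) = 4 * l - 2 * (l - 1 - k) by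
      omega, show 2 * l - (2 * l - (l - 1 - k)) = l - 1 - k by omega]
    simp only [map_mul, map_pow, map_neg, map_one]
    ring

end Expansion

/-! ### The correlation function and the dimension formula -/

namespace VOA

section Main

variable {V : Type*} [AddCommGroup V] [Module ℂ V] {A : VOA V} {B : LinearMap.BilinForm ℂ V}
  {l : ℕ} {u : Module.Basis (Fin (A.primaryDim l)) ℂ (A.primary l)}
  {u' : Fin (A.primaryDim l) → A.primary l} {a b : V}

namespace IsExceptional

theorem det_ne (hE : A.IsExceptional B l) {n : ℕ} (hn : n ≤ 2 * l + 2) :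
    (virGram A.c n).det ≠ 0 :=
  hE.form.det_virGram_ne hE.strongCFT hE.noSingular hn

theorem hasVal_v (hE : A.IsExceptional B l) {k : ℕ} (hk : k ≤ l + 1) :
    HasVal (vCoeff l k) A.c (vVal A.c l k) :=
  hasVal_vCoeff fun n hn => hE.det_ne (by omega)

theorem hasVal_w (hE : A.IsExceptional B l) {j : ℕ} (hj : j < l) :
    HasVal (wCoeff l j) A.c (wVal A.c l j) :=
  hasVal_wCoeff fun n hn => hE.det_ne (by omega)

theorem corrCoeff_eq_expansionCoeff (hE : A.IsExceptional B l) (hd : A.IsDualBasis B l u u')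
    (ha : a ∈ A.primary l) (hb : b ∈ A.primary l) (m n : ℤ) :
    A.corrCoeff B l u u' a b m n = expansionCoeff l
      (MvPolynomial.C (B a b) * genusZeroPoly l (A.primaryDim l) A.c) (-m - 1) (-n - 1) := by
  have hG : (MvPolynomial.C (B a b) * genusZeroPoly l (A.primaryDim l) A.c).IsHomogeneous (4 * l) :=
    (genusZeroPoly_isHomogeneous l _ _).C_mul _
  by_cases hmn : m + n = 2 * l - 2
  · have hcorr : A.corrCoeff B l u u' a b m n =
        ∑ i, A.productElt B l a b (u i) (u' i) (m + 1) := by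
      refine Finset.sum_congr rfl fun i _ => ?_
      rw [productElt, show m + 1 - 1 = m by ring, show 2 * (l : ℤ) - 1 - (m + 1) = n by omega]
    rw [hcorr]
    rcases lt_or_ge (m + 1) 0 with hneg | hpos
    · rw [expansionCoeff_eq_zero hG (by omega)]
      exact Finset.sum_eq_zero fun i _ =>
        productElt_neg hE.strongCFT hb (u' i).2 a _ hneg
    · obtain ⟨N, hN⟩ := Int.eq_ofNat_of_zero_le hpos
      obtain ⟨g, hg, hgv, hgw⟩ := hE.exists_expansion hd ha hb
      rw [hN, show -m - 1 = -(N : ℤ) by omega, show -n - 1 = (N : ℤ) - 2 * l by omega,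
        expansionCoeff_eq hE.one_le hG,
        dehomogenise_genusZeroPoly (g := g)
          (fun k hk => by rw [(hE.hasVal_v (by omega)).evalC_eq]; exact hgv k (by omega))
          (fun j hj => by rw [(hE.hasVal_w hj).evalC_eq]; exact hgw j hj),
        ← PowerSeries.eq_oneSubZPow_mul hg, map_sum]
      exact Finset.sum_congr rfl fun i _ => by rw [productSeries, PowerSeries.coeff_mk]
  · rw [expansionCoeff_eq_zero hG (by omega)]
    refine Finset.sum_eq_zero fun i _ => ?_
    refine hE.form.eq_zero_of_wt_ne (m := l) (n := 3 * l - 2 - m - n) (by omega)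
      (A.mem_primary.1 ha).1 ?_
    refine A.mode_mem_wt' (A.mem_primary.1 (u i).2).1
      (A.mode_mem_wt (A.mem_primary.1 (u' i).2).1 (A.mem_primary.1 hb).1 n) ?_
    ring

/-- The coefficient g_(l+1) is known from both expansions. A pair of primaries with nonzero pairing
allows the common factor to be cancelled. -/
theorem primaryDim_mul_vVal (hE : A.IsExceptional B l) :
    (A.primaryDim l : ℂ) * vVal A.c l (l + 1) = wVal A.c l (l - 1) := by
  obtain ⟨u, u', hd⟩ := hE.exists_dualBasis
  obtain ⟨a, ha, ha0⟩ := Submodule.exists_mem_ne_zero_of_ne_bot hE.primary_ne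
  obtain ⟨b, hb, hab⟩ : ∃ b ∈ A.primary l, B b a ≠ 0 := by
    by_contra! h
    exact ha0 (hE.eq_zero_of_primary_orthogonal ha h)
  have hl := hE.one_le
  obtain ⟨g, -, hgv, hgw⟩ := hE.exists_expansion hd hb ha
  have h1 := hgv (l + 1) le_rfl
  have h2 := hgw (l - 1) (by omega)
  rw [show 2 * l - (l - 1) = l + 1 by omega, h1, mul_assoc] at h2
  exact mul_left_cancel₀ (mul_ne_zero (pow_ne_zero _ (by norm_num)) hab) h2

end IsExceptional

end Main

end VOA

theorem mainTheorem4 (l : ℕ) (hl : 1 ≤ l) :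
    (binomMatrix l).det = 1 ∧
    vCoeff l (l + 1) ≠ 0 ∧
    ∀ (V : Type*) [AddCommGroup V] [Module ℂ V] (A : VOA V) (B : LinearMap.BilinForm ℂ V),
      A.IsExceptional B l →
        -- the rational functions below have no pole at the central charge
        (∀ k ≤ l + 1, IsRegularAt (vCoeff l k) A.c) ∧
        (∀ j < l, IsRegularAt (wCoeff l j) A.c) ∧
        -- the correlation function
        (∀ u u', A.IsDualBasis B l u u' → ∀ a ∈ A.primary l, ∀ b ∈ A.primary l,
          ∃ G : MvPolynomial (Fin 2) ℂ,
            G = MvPolynomial.C (B a b) * genusZeroPoly l (A.primaryDim l) A.c ∧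
            G.IsSymmetric ∧ G.IsHomogeneous (4 * l) ∧
            ∀ m n : ℤ,
              A.corrCoeff B l u u' a b m n = expansionCoeff l G (-m - 1) (-n - 1)) ∧
        -- the dimension of the space of primary vectors of weight `l`
        (A.primaryDim l : ℂ) * evalC (vCoeff l (l + 1)) A.c = evalC (wCoeff l (l - 1)) A.c ∧
        (evalC (vCoeff l (l + 1)) A.c ≠ 0 →
          IsRegularAt (plFun l) A.c ∧ (A.primaryDim l : ℂ) = evalC (plFun l) A.c) := by
  refine ⟨binomMatrix_det l, vCoeff_succ_ne_zero hl l, fun V _ _ A B hE => ?_⟩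
  have hv := hE.hasVal_v (le_refl (l + 1))
  have hw := hE.hasVal_w (show l - 1 < l by omega)
  have hdim := hE.primaryDim_mul_vVal
  refine ⟨fun k hk => (hE.hasVal_v hk).isRegularAt, fun j hj => (hE.hasVal_w hj).isRegularAt,
    fun u u' hd a ha b hb => ⟨_, rfl, ?_, (genusZeroPoly_isHomogeneous l _ _).C_mul _,
      hE.corrCoeff_eq_expansionCoeff hd ha hb⟩, ?_, fun hne => ?_⟩
  · exact (MvPolynomial.IsSymmetric.C _).mul (genusZeroPoly_isSymmetric l _ _)
  · rw [hv.evalC_eq, hw.evalC_eq, hdim]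
  · rw [hv.evalC_eq] at hne
    have hpl : HasVal (plFun l) A.c (wVal A.c l (l - 1) * (vVal A.c l (l + 1))⁻¹) := by
      rw [plFun, div_eq_mul_inv]
      exact hw.mul (hv.inv hne)
    refine ⟨hpl.isRegularAt, ?_⟩
    rw [hpl.evalC_eq, ← hdim, mul_inv_cancel_right₀ hne]
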